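/- There is an absolute constant $C>0$ such that the following holds. Let $d\in\mathbb N$, let $\mathcal X\subset\mathbb R^d$ be a set with $x^\top y\in[0,1]$ for all $x,y\in\mathcal X$, let $F$ be a probability distribution on $\mathcal X$ whose second moment matrix $\Delta=\mathbb E_{Y\sim F}[YY^\top]$ has rank $d$, and let $(\rho_n)_{n}$ be a sequence with $0<\rho_n\le 1$. For each $n$ let $(X,A)\sim\mathrm{RDPG}(F)$ on $n$ vertices with sparsity factor $\rho_n$; that is, the latent positions $X_1,\dots,X_n$ are i.i.d. with law $F$, and $A\in\{0,1\}^{n\times n}$ is a symmetric matrix with zero diagonal whose conditional distribution given $X=(X_1,\dots,X_n)$ is $$\Pr[A\mid X]=\prod_{i<j}(\rho_n X_i^\top X_j)^{A_{ij}}(1-\rho_n X_i^\top X_j)^{1-A_{ij}} .$$ An adjacency spectral embedding of $A$ into $\mathbb R^d$ (for $n\ge d$) is a matrix $\hat X=U_AS_A^{1/2}\in\mathbb R^{n\times d}$, where $S_A$ is the diagonal matrix of the $d$ largest eigenvalues (with multiplicity, in decreasing order) of $|A|=(A^\top A)^{1/2}$ and the columns of $U_A$ are corresponding orthonormal eigenvectors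 of $|A|$; its $i$-th row is written $\hat X_i$. Let $E_n$ be the event that for every adjacency spectral embedding $\hat X$ of $A$ (i.e. for every choice of the eigenvectors) there is an orthogonal matrix $W\in\mathbb R^{d\times d}$ with $$\max_{1\le i\le n}\bigl\|\hat X_i-\rho_n^{1/2}\,W X_i\bigr\|\le\frac{C\,d^{1/2}\log^2 n}{\sqrt{n\rho_n}} .$$ Then $E_n$ occurs asymptotically almost surely, in the following sense: for every $c>0$ there is $n_0$ such that $\Pr(E_n)\ge 1-\eta$ for all $n>n_0$ and all $\eta$ with $n^{-c}<\eta<1/2$ (in particular $\Pr(E_n)\to1$). -/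

import Mathlib

open MeasureTheory ProbabilityTheory

open scoped Matrix MatrixOrder

noncomputable section

/-- The absolute value `|A| = (Aᵀ A)^{1/2}` of a real square matrix: the positive semidefinite
square root of `Aᵀ A`. -/
def matrixAbs {n : ℕ} (A : Matrix (Fin n) (Fin n) ℝ) : Matrix (Fin n) (Fin n) ℝ :=
  CFC.sqrt (Aᵀ * A)

/-- `Xhat` (given by its rows) is an adjacency spectral embedding `U_A S_A^{1/2}` of `A` into `ℝ^d`:
for some spectral decomposition `|A| = V diag(s) Vᵀ`, with `V` orthogonal and `s` in decreasing
order, `S_A` holds the first `d` eigenvalues and `U_A` the first `d` columns of `V`.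
Eigenvectors are not unique, so this is a relation. -/
def IsASE {n d : ℕ} (A : Matrix (Fin n) (Fin n) ℝ)
    (Xhat : Fin n → EuclideanSpace ℝ (Fin d)) : Prop :=
  ∃ (h : d ≤ n) (V : Matrix (Fin n) (Fin n) ℝ) (s : Fin n → ℝ),
    V ∈ Matrix.orthogonalGroup (Fin n) ℝ ∧ Antitone s ∧
    matrixAbs A = V * Matrix.diagonal s * Vᵀ ∧
    ∀ i k, Xhat i k = V i (Fin.castLE h k) * √(s (Fin.castLE h k))

/-- The second moment matrix `E[X₁ X₁ᵀ]` of a random vector with law `F`. -/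
def secondMoment {d : ℕ} (F : Measure (EuclideanSpace ℝ (Fin d))) : Matrix (Fin d) (Fin d) ℝ :=
  Matrix.of fun j k => ∫ x, x j * x k ∂F

/-- Symmetric hollow matrices with entries in `{0, 1}`. -/
structure IsAdjacency {n : ℕ} (a : Matrix (Fin n) (Fin n) ℝ) : Prop where
  symm : ∀ i j, a i j = a j i
  hollow : ∀ i, a i i = 0
  zero_or_one : ∀ i j, a i j = 0 ∨ a i j = 1

/-- The probability `∏_{i<j} (r xᵢᵀxⱼ)^{a i j} (1 - r xᵢᵀxⱼ)^{1 - a i j}` of the adjacency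
matrix `a` given the latent positions `x` and the sparsity factor `r`. -/
def edgeLikelihood {n d : ℕ} (r : ℝ) (x : Fin n → EuclideanSpace ℝ (Fin d))
    (a : Matrix (Fin n) (Fin n) ℝ) : ℝ :=
  ∏ p : Fin n × Fin n with p.1 < p.2,
    if a p.1 p.2 = 1 then r * inner ℝ (x p.1) (x p.2) else 1 - r * inner ℝ (x p.1) (x p.2)

/-- `(X, A)` is a random dot product graph on `n` vertices with latent position distribution `F`
and sparsity factor `r`: the latent positions are i.i.d. with law `F`, `A` is a random adjacency
matrix, and the conditional probability of `A = a` given `X` is `edgeLikelihood r X a`. -/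
structure IsRDPG {Ω : Type*} [MeasurableSpace Ω] (μ : Measure Ω) {n d : ℕ}
    (F : Measure (EuclideanSpace ℝ (Fin d))) (r : ℝ)
    (X : Ω → Fin n → EuclideanSpace ℝ (Fin d)) (A : Ω → Matrix (Fin n) (Fin n) ℝ) : Prop where
  measurable_pos : ∀ i, Measurable fun ω => X ω i
  law_pos : ∀ i, μ.map (fun ω => X ω i) = F
  indep_pos : iIndepFun (fun i ω => X ω i) μ
  measurable_adj : ∀ i j, Measurable fun ω => A ω i j
  isAdjacency : ∀ ω, IsAdjacency (A ω)
  condProb : ∀ a : Matrix (Fin n) (Fin n) ℝ, IsAdjacency a →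
    μ⟦{ω | A ω = a} | MeasurableSpace.comap X inferInstance⟧
      =ᵐ[μ] fun ω => edgeLikelihood r (X ω) a

/-- The events `E n` occur asymptotically almost surely: for every `c > 0`, for all large `n`,
`P(E n) ≥ 1 - η` whenever `n^{-c} < η < 1/2`. -/
def AsympAlmostSurely {Ω : ℕ → Type*} [∀ n, MeasurableSpace (Ω n)] (μ : ∀ n, Measure (Ω n))
    (E : ∀ n, Set (Ω n)) : Prop :=
  ∀ c : ℝ, 0 < c → ∃ n₀ : ℕ, ∀ n : ℕ, n₀ < n → ∀ η : ℝ,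
    (n : ℝ) ^ (-c) < η → η < 1 / 2 → 1 - η ≤ (μ n).real (E n)

/-- For every adjacency spectral embedding `Xhat` of `A` there is an orthogonal `W` with
`‖Xhat i - r^{1/2} W x i‖ ≤ C d^{1/2} log² n / √(n r)` for all vertices `i`. -/
def EmbeddingErrorBound {n d : ℕ} (C r : ℝ) (x : Fin n → EuclideanSpace ℝ (Fin d))
    (A : Matrix (Fin n) (Fin n) ℝ) : Prop :=
  ∀ Xhat : Fin n → EuclideanSpace ℝ (Fin d), IsASE A Xhat →
    ∃ W ∈ Matrix.orthogonalGroup (Fin d) ℝ, ∀ i,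
      ‖Xhat i - √r • Matrix.toEuclideanLin W (x i)‖
        ≤ C * √d * Real.log n ^ 2 / √(n * r)

end

/-! The proof splits at nρ = log² n. In the dense regime the error obtained is O(log n / √(nρ)), so
one of the two logarithms in the target is spare; it absorbs every constant depending on d, F and c.
Hence C = 1 works, and the thresholds on n do not involve ρ.

Sparse regime. The target is at least log n. Truncating |A| to d eigenvalues only decreases its
diagonal, and (|A|ᵢᵢ)² ≤ (A²)ᵢᵢ is the degree, so ‖X̂ᵢ‖⁴ ≤ deg i (`IsASE.norm_pow_four_le`). A
Chernoff bound makes all degrees O(log² n), so the rows of X̂ are O(√log n) and W = 1 suffices.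

Dense regime. Put Y = √ρ X. Given X, A - YYᵀ is the centered noise H minus a diagonal with entries
at most 1. With probability 1 - O(n^(-c-1)) three things hold: YᵀY ≥ δnρ (Hoeffding for each entry,
and Δ has full rank), ‖H‖ = O(√(nρ log n)) (trace method, `sum_bernoulliWeight_mul_trace_le`), and
the entries of HY are O(√(nρ log n)) (Chernoff, `bernoulliProb_row_le`).

The rest is deterministic (`ase_row_bound`). Write |A| = A + 2N with N the negative part of A; N is
small because A is near the positive semidefinite YYᵀ, and NY is smaller still. Let D = |A| - YYᵀ
and Z = US^(-1/2). Then X̂ = |A|Z = Y(YᵀZ) + R with R = DZ. Since Z = X̂S⁻¹, substituting once more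
gives R = DY(YᵀZ)S⁻¹ + DRS⁻¹: the rows of R are controlled by the rows of DY, up to a second-order
term for which the operator norm is enough. The orthogonal W comes from the polar decomposition of
JX̂, where J is the left inverse of Y (`exists_orthogonal_row_bound`). No individual eigenvectors
are compared, so gaps among the leading eigenvalues play no role. -/

/-! ### Operator norms, polar decomposition, negative parts and the rowwise comparison. -/

section LinearAlgebra

open scoped Matrix.Norms.L2Operator

variable {n m d : ℕ}

lemma Matrix.l2_opNorm_transpose (M : Matrix (Fin n) (Fin m) ℝ) : ‖Mᵀ‖ = ‖M‖ := by
  rw [← Matrix.conjTranspose_eq_transpose_of_trivial, Matrix.l2_opNorm_conjTranspose]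

lemma Matrix.l2_opNorm_le_of_mulVec {M : Matrix (Fin n) (Fin m) ℝ} {c : ℝ} (hc : 0 ≤ c)
    (h : ∀ v : EuclideanSpace ℝ (Fin m), ‖WithLp.toLp 2 (M *ᵥ v.ofLp)‖ ≤ c * ‖v‖) : ‖M‖ ≤ c := by
  rw [Matrix.l2_opNorm_def]
  exact ContinuousLinearMap.opNorm_le_bound _ hc fun v => h v

lemma norm_row_mul_le (M : Matrix (Fin n) (Fin m) ℝ) (N : Matrix (Fin m) (Fin d) ℝ) (i : Fin n) :
    ‖WithLp.toLp 2 ((M * N) i)‖ ≤ ‖WithLp.toLp 2 (M i)‖ * ‖N‖ := by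
  have h := Matrix.l2_opNorm_mulVec Nᵀ (WithLp.toLp 2 (M i))
  rw [Matrix.l2_opNorm_transpose, mul_comm] at h
  convert h using 3
  rw [Matrix.mulVec_transpose]
  rfl

lemma norm_row_le (M : Matrix (Fin n) (Fin m) ℝ) (i : Fin n) :
    ‖WithLp.toLp 2 (M i)‖ ≤ ‖M‖ := by
  have h := norm_row_mul_le (1 : Matrix (Fin n) (Fin n) ℝ) M i
  rw [Matrix.one_mul] at h
  have h1 : ‖WithLp.toLp 2 ((1 : Matrix (Fin n) (Fin n) ℝ) i)‖ = 1 := by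
    have : WithLp.toLp 2 ((1 : Matrix (Fin n) (Fin n) ℝ) i) = EuclideanSpace.single i 1 := by
      ext j
      simp [Matrix.one_apply, eq_comm]
    rw [this]; simp
  rwa [h1, one_mul] at h

lemma Matrix.norm_sq_toLp_mulVec (M : Matrix (Fin n) (Fin m) ℝ) (v : Fin m → ℝ) :
    ‖WithLp.toLp 2 (M *ᵥ v)‖ ^ 2 = v ⬝ᵥ ((Mᵀ * M) *ᵥ v) := by
  rw [EuclideanSpace.real_norm_sq_eq, ← Matrix.mulVec_mulVec, Matrix.dotProduct_mulVec,
    Matrix.vecMul_transpose]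
  simp [dotProduct, sq]

lemma norm_sq_toLp_eq_dotProduct (v : Fin m → ℝ) : ‖WithLp.toLp 2 v‖ ^ 2 = v ⬝ᵥ v := by
  rw [EuclideanSpace.real_norm_sq_eq]
  simp [dotProduct, sq]

lemma abs_dotProduct_le_norm (v w : Fin m → ℝ) :
    |v ⬝ᵥ w| ≤ ‖WithLp.toLp 2 v‖ * ‖WithLp.toLp 2 w‖ := by
  have := abs_real_inner_le_norm (WithLp.toLp 2 v) (WithLp.toLp 2 w)
  rwa [EuclideanSpace.inner_toLp_toLp, star_trivial, dotProduct_comm] at this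

lemma abs_dotProduct_mulVec_le (M : Matrix (Fin m) (Fin m) ℝ) (v : Fin m → ℝ) :
    |v ⬝ᵥ (M *ᵥ v)| ≤ ‖M‖ * (v ⬝ᵥ v) := by
  have h1 := abs_dotProduct_le_norm v (M *ᵥ v)
  have h2 := Matrix.l2_opNorm_mulVec M (WithLp.toLp 2 v)
  rw [← norm_sq_toLp_eq_dotProduct]
  calc _ ≤ _ := h1
    _ ≤ ‖WithLp.toLp 2 v‖ * (‖M‖ * ‖WithLp.toLp 2 v‖) := by gcongr; exact h2
    _ = _ := by ring

/-- For H = qᵀq the quadratic form is ‖qv‖², and the C*-identity gives ‖H‖ = ‖q‖². -/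
lemma Matrix.PosSemidef.l2_opNorm_le {H : Matrix (Fin m) (Fin m) ℝ} (hH : H.PosSemidef) {c : ℝ}
    (hc : 0 ≤ c) (h : ∀ v : Fin m → ℝ, v ⬝ᵥ (H *ᵥ v) ≤ c * (v ⬝ᵥ v)) : ‖H‖ ≤ c := by
  obtain ⟨q, rfl⟩ : ∃ q : Matrix (Fin m) (Fin m) ℝ, H = qᴴ * q := by
    have hq : (CFC.sqrt H).PosSemidef := Matrix.nonneg_iff_posSemidef.mp (CFC.sqrt_nonneg _)
    exact ⟨CFC.sqrt H, by rw [hq.isHermitian.eq, CFC.sqrt_mul_sqrt_self _ hH.nonneg]⟩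
  rw [Matrix.l2_opNorm_conjTranspose_mul_self]
  have hq : ‖q‖ ≤ √c := by
    refine Matrix.l2_opNorm_le_of_mulVec (Real.sqrt_nonneg c) fun v => ?_
    refine abs_le_of_sq_le_sq' ?_ (by positivity) |>.2
    have := h v.ofLp
    rw [Matrix.conjTranspose_eq_transpose_of_trivial, ← Matrix.norm_sq_toLp_mulVec,
      ← norm_sq_toLp_eq_dotProduct] at this
    rw [mul_pow, Real.sq_sqrt hc]
    exact this
  calc ‖q‖ * ‖q‖ ≤ √c * √c := by gcongr
    _ = c := Real.mul_self_sqrt hc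

lemma l2_opNorm_le_one_of_transpose_mul_self {U : Matrix (Fin n) (Fin m) ℝ} (hU : Uᵀ * U = 1) :
    ‖U‖ ≤ 1 := by
  refine Matrix.l2_opNorm_le_of_mulVec zero_le_one fun v => ?_
  refine abs_le_of_sq_le_sq' ?_ (by positivity) |>.2
  rw [Matrix.norm_sq_toLp_mulVec, hU, Matrix.one_mulVec, ← norm_sq_toLp_eq_dotProduct, one_mul]

/-- A square matrix whose Gram matrix is close to the identity is close to an orthogonal matrix. -/
lemma exists_orthogonal_near {N : Matrix (Fin d) (Fin d) ℝ} {ε : ℝ} (hε : ε < 1)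
    (hN : ‖N * Nᵀ - 1‖ ≤ ε) :
    ∃ W ∈ Matrix.orthogonalGroup (Fin d) ℝ, ‖N - W‖ ≤ ε := by
  have hε0 : 0 ≤ ε := (norm_nonneg _).trans hN
  have hT : (N * Nᵀ).PosSemidef := by
    simpa using Matrix.posSemidef_self_mul_conjTranspose N
  -- Polar decomposition N = QW: the hypothesis ε < 1 makes Q invertible, and W = Q⁻¹N.
  set Q := CFC.sqrt (N * Nᵀ) with hQ
  have hQQ : Q * Q = N * Nᵀ := CFC.sqrt_mul_sqrt_self _ hT.nonneg
  have hQ0 : Q.PosSemidef := Matrix.nonneg_iff_posSemidef.mp (CFC.sqrt_nonneg _)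
  have hQt : Qᵀ = Q := by
    simpa using hQ0.isHermitian.eq
  have hinj : ∀ v : Fin d → ℝ, (Q * Q) *ᵥ v = 0 → v = 0 := by
    intro v hv
    have h1 := (abs_le.mp (abs_dotProduct_mulVec_le (N * Nᵀ - 1) v)).1
    rw [Matrix.sub_mulVec, ← hQQ, hv, Matrix.one_mulVec, zero_sub, dotProduct_neg] at h1
    rw [← hQQ] at hN
    have h0 : 0 ≤ v ⬝ᵥ v := by rw [← norm_sq_toLp_eq_dotProduct]; positivity
    have h2 : v ⬝ᵥ v ≤ ε * (v ⬝ᵥ v) := by nlinarith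
    have : v ⬝ᵥ v = 0 := by nlinarith
    exact dotProduct_self_eq_zero.mp this
  have hdet : IsUnit (Q * Q).det := by
    rw [isUnit_iff_ne_zero]
    intro h0
    obtain ⟨v, hv, hv'⟩ := Matrix.exists_mulVec_eq_zero_iff.mpr h0
    exact hv (hinj v hv')
  have hdQ : IsUnit Q.det := by
    rw [Matrix.det_mul] at hdet
    exact isUnit_of_mul_isUnit_left hdet
  have hW : Q⁻¹ * N ∈ Matrix.orthogonalGroup (Fin d) ℝ := by
    rw [Matrix.mem_orthogonalGroup_iff, Matrix.transpose_mul,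
      Matrix.transpose_nonsing_inv, hQt,
      show Q⁻¹ * N * (Nᵀ * Q⁻¹) = Q⁻¹ * (N * Nᵀ) * Q⁻¹ by simp only [Matrix.mul_assoc], ← hQQ,
      ← Matrix.mul_assoc, Matrix.nonsing_inv_mul _ hdQ, one_mul, Matrix.mul_nonsing_inv _ hdQ]
  refine ⟨_, hW, ?_⟩
  have hW1 : ‖Q⁻¹ * N‖ ≤ 1 := by
    refine l2_opNorm_le_one_of_transpose_mul_self ?_
    exact mul_eq_one_comm.mp ((Matrix.mem_orthogonalGroup_iff _ _).mp hW)
  have hQ1 : ‖Q - 1‖ ≤ ε := by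
    refine Matrix.l2_opNorm_le_of_mulVec hε0 fun v => ?_
    -- Since Q ≥ 0, the factor Q + 1 does not shrink vectors. As (Q + 1)(Q - 1) = NNᵀ - 1, the bound
    -- ε passes to Q - 1 without loss.
    have hexp : ∀ w : Fin d → ℝ, ‖WithLp.toLp 2 w‖ ^ 2 ≤ ‖WithLp.toLp 2 w‖ *
        ‖WithLp.toLp 2 ((Q + 1) *ᵥ w)‖ := by
      intro w
      refine le_trans ?_ ((le_abs_self _).trans (abs_dotProduct_le_norm w ((Q + 1) *ᵥ w)))
      rw [Matrix.add_mulVec, Matrix.one_mulVec, dotProduct_add, ← norm_sq_toLp_eq_dotProduct]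
      have := hQ0.dotProduct_mulVec_nonneg w
      simp only [star_trivial] at this
      linarith
    have hprod : (Q + 1) *ᵥ ((Q - 1) *ᵥ v.ofLp) = (N * Nᵀ - 1) *ᵥ v.ofLp := by
      rw [Matrix.mulVec_mulVec, ← hQQ]
      congr 1
      noncomm_ring
    have h1 := hexp ((Q - 1) *ᵥ v.ofLp)
    rw [hprod] at h1
    have h2 := Matrix.l2_opNorm_mulVec (N * Nᵀ - 1) v
    have h3 : ‖WithLp.toLp 2 ((N * Nᵀ - 1) *ᵥ v.ofLp)‖ ≤ ε * ‖v‖ := h2.trans (by gcongr)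
    rcases (norm_nonneg (WithLp.toLp 2 ((Q - 1) *ᵥ v.ofLp))).eq_or_lt with h0 | h0
    · rw [← h0]; positivity
    · rw [sq] at h1
      exact (le_of_mul_le_mul_left h1 h0).trans h3
  have : N - Q⁻¹ * N = (Q - 1) * (Q⁻¹ * N) := by
    rw [sub_mul, ← Matrix.mul_assoc, Matrix.mul_nonsing_inv _ hdQ, one_mul, one_mul]
  rw [this]
  calc _ ≤ ‖Q - 1‖ * ‖Q⁻¹ * N‖ := Matrix.l2_opNorm_mul _ _
    _ ≤ ε * 1 := by gcongr
    _ = ε := mul_one ε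

/-- The C*-identity applied twice. It turns a bound on the cube of the negative part into one on its
norm. -/
lemma Matrix.IsHermitian.l2_opNorm_pow_four {N : Matrix (Fin m) (Fin m) ℝ} (hN : N.IsHermitian) :
    ‖N * N * N * N‖ = ‖N‖ ^ 4 := by
  have h1 : ‖N * N‖ = ‖N‖ * ‖N‖ := by
    have := Matrix.l2_opNorm_conjTranspose_mul_self N
    rwa [hN.eq] at this
  have h2 : ‖N * N * (N * N)‖ = ‖N * N‖ * ‖N * N‖ := by
    have := Matrix.l2_opNorm_conjTranspose_mul_self (N * N)
    rwa [Matrix.conjTranspose_mul, hN.eq] at this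
  rw [Matrix.mul_assoc, h2, h1]
  ring

/-- The absolute value of a symmetric matrix `A` is `A + 2 N`, where `N` is the negative part. If
`A` is close to a positive semidefinite matrix `P` then `N` is small, and smaller still along the
range of `P`. -/
lemma exists_matrixAbs_eq_add {A P : Matrix (Fin m) (Fin m) ℝ} (hA : A.IsHermitian)
    (hP : P.PosSemidef) {σ : ℝ} (hσ : ‖A - P‖ ≤ σ) :
    ∃ N : Matrix (Fin m) (Fin m) ℝ, matrixAbs A = A + 2 • N ∧ ‖N‖ ≤ σ ∧ ‖N * P‖ ≤ 2 * σ ^ 2 := by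
  have hσ0 : 0 ≤ σ := (norm_nonneg _).trans hσ
  have hsa : IsSelfAdjoint A := hA
  have hN : (A⁻).PosSemidef := Matrix.nonneg_iff_posSemidef.mp (CFC.negPart_nonneg A)
  set N := A⁻ with hNdef
  have hNA : N * A = -(N * N) := by
    conv_lhs => rw [← CFC.posPart_sub_negPart A hsa]
    rw [mul_sub, CFC.negPart_mul_posPart, zero_sub]
  have habs : matrixAbs A = A + 2 • N := by
    have h := CFC.abs_sub_self A hsa
    rw [← hNdef, sub_eq_iff_eq_add, add_comm] at h
    rw [← h, matrixAbs, CFC.abs, Matrix.star_eq_conjTranspose,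
      Matrix.conjTranspose_eq_transpose_of_trivial]
  have hcube : (N * N * N).PosSemidef := by
    have := hN.conjTranspose_mul_mul_same N
    rwa [hN.isHermitian.eq] at this
  have hNt : Nᵀ = N := by simpa using hN.isHermitian.eq
  -- Because NA = -N², the form of N³ at v equals minus the form of A at Nv. The latter is at most
  -- σ‖Nv‖², since A exceeds -σ by positivity of P.
  have hle : ‖N * N * N‖ ≤ σ * ‖N‖ ^ 2 := by
    refine hcube.l2_opNorm_le (by positivity) fun v => ?_
    have e1 : v ⬝ᵥ ((N * N * N) *ᵥ v) = -((N *ᵥ v) ⬝ᵥ (A *ᵥ (N *ᵥ v))) := by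
      rw [Matrix.dotProduct_mulVec (N *ᵥ v) A, ← Matrix.mulVec_transpose,
        show Aᵀ = A by simpa using hA.eq, dotProduct_comm, Matrix.dotProduct_mulVec,
        ← Matrix.mulVec_transpose, hNt, dotProduct_comm, Matrix.mulVec_mulVec, Matrix.mulVec_mulVec,
        hNA, Matrix.neg_mul, Matrix.neg_mulVec, neg_dotProduct, neg_neg,
        dotProduct_comm]
    have e2 := (abs_le.mp (abs_dotProduct_mulVec_le (A - P) (N *ᵥ v))).1
    have e3 := hP.dotProduct_mulVec_nonneg (N *ᵥ v)
    rw [star_trivial] at e3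
    rw [Matrix.sub_mulVec, dotProduct_sub] at e2
    have e4 : (N *ᵥ v) ⬝ᵥ (N *ᵥ v) ≤ ‖N‖ ^ 2 * (v ⬝ᵥ v) := by
      rw [← norm_sq_toLp_eq_dotProduct, ← norm_sq_toLp_eq_dotProduct, ← mul_pow]
      gcongr
      exact Matrix.l2_opNorm_mulVec N (WithLp.toLp 2 v)
    have e5 : 0 ≤ (N *ᵥ v) ⬝ᵥ (N *ᵥ v) := by rw [← norm_sq_toLp_eq_dotProduct]; positivity
    rw [e1]
    calc _ ≤ ‖A - P‖ * ((N *ᵥ v) ⬝ᵥ (N *ᵥ v)) := by linarith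
      _ ≤ σ * (‖N‖ ^ 2 * (v ⬝ᵥ v)) := by gcongr
      _ = _ := by ring
  have hNσ : ‖N‖ ≤ σ := by
    rcases (norm_nonneg N).eq_or_lt with h0 | h0
    · rwa [← h0]
    · have h4 := hN.isHermitian.l2_opNorm_pow_four
      have h5 : ‖N‖ ^ 4 ≤ σ * ‖N‖ ^ 2 * ‖N‖ := by
        rw [← h4]
        exact (Matrix.l2_opNorm_mul _ _).trans (by gcongr)
      have h6 : ‖N‖ ^ 3 * ‖N‖ ≤ ‖N‖ ^ 3 * σ := by linarith
      exact le_of_mul_le_mul_left h6 (by positivity)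
  refine ⟨N, habs, hNσ, ?_⟩
  have : N * P = -(N * N) - N * (A - P) := by
    rw [mul_sub, hNA]; abel
  rw [this]
  calc _ ≤ ‖-(N * N)‖ + ‖N * (A - P)‖ := norm_sub_le _ _
    _ ≤ σ * σ + σ * σ := by
        rw [norm_neg]
        gcongr
        · exact (Matrix.l2_opNorm_mul _ _).trans (by gcongr)
        · exact (Matrix.l2_opNorm_mul _ _).trans (by gcongr)
    _ = _ := by ring

/-- Rowwise comparison of two `n × d` matrices `Xh`, `Y` with `B Z = Xh` and `Z = Xh T`, where `B`
is close to `Y Yᵀ`. -/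
lemma exists_orthogonal_row_bound {B : Matrix (Fin n) (Fin n) ℝ}
    {Y Xh Z : Matrix (Fin n) (Fin d) ℝ} {T : Matrix (Fin d) (Fin d) ℝ}
    {J : Matrix (Fin d) (Fin n) ℝ} {β y z t j κ : ℝ}
    (hBZ : B * Z = Xh) (hZT : Z = Xh * T) (hJ : J * Y = 1)
    (hB : ‖B - Y * Yᵀ‖ ≤ β) (hX : ‖Xh * Xhᵀ - Y * Yᵀ‖ ≤ 2 * β)
    (hY : ‖Y‖ ≤ y) (hZ : ‖Z‖ ≤ z) (hT : ‖T‖ ≤ t) (hJj : ‖J‖ ≤ j)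
    (hrow : ∀ i, ‖WithLp.toLp 2 (((B - Y * Yᵀ) * Y) i)‖ ≤ κ)
    (hYrow : ∀ i, ‖WithLp.toLp 2 (Y i)‖ ≤ 1) (hsmall : j * (2 * β) * j < 1) :
    ∃ W ∈ Matrix.orthogonalGroup (Fin d) ℝ, ∀ i,
      ‖WithLp.toLp 2 ((Xh - Y * W) i)‖ ≤
        κ * (y * z * t) + β * (β * z) * t + j * (β * z) + j * (2 * β) * j := by
  have hβ0 : 0 ≤ β := (norm_nonneg _).trans hB
  have hy0 : 0 ≤ y := (norm_nonneg _).trans hY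
  have hz0 : 0 ≤ z := (norm_nonneg _).trans hZ
  have ht0 : 0 ≤ t := (norm_nonneg _).trans hT
  have hj0 : 0 ≤ j := (norm_nonneg _).trans hJj
  have hYT : Yᵀ * Jᵀ = 1 := by rw [← Matrix.transpose_mul, hJ, Matrix.transpose_one]
  -- J Y = 1 turns the closeness of the two rank-d matrices into near-orthogonality of J Xh.
  have hN : ‖J * Xh * (J * Xh)ᵀ - 1‖ ≤ j * (2 * β) * j := by
    have e : J * Xh * (J * Xh)ᵀ - 1 = J * (Xh * Xhᵀ - Y * Yᵀ) * Jᵀ := by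
      rw [Matrix.transpose_mul, Matrix.mul_sub, Matrix.sub_mul]
      congr 1
      · simp only [Matrix.mul_assoc]
      · rw [← Matrix.mul_assoc J, hJ, Matrix.one_mul, hYT]
    rw [e]
    refine (Matrix.l2_opNorm_mul _ _).trans ?_
    rw [Matrix.l2_opNorm_transpose]
    gcongr
    exact (Matrix.l2_opNorm_mul _ _).trans (by gcongr)
  obtain ⟨W, hW, hNW⟩ := exists_orthogonal_near hsmall hN
  refine ⟨W, hW, fun i => ?_⟩
  set D := B - Y * Yᵀ with hD
  set M := Yᵀ * Z with hM
  set R := D * Z with hR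
  have hXh : Xh = Y * M + R := by
    rw [hR, hD, hM, Matrix.sub_mul, hBZ, Matrix.mul_assoc]; abel
  have hRnorm : ‖R‖ ≤ β * z := (Matrix.l2_opNorm_mul _ _).trans (by gcongr)
  have hMnorm : ‖M‖ ≤ y * z := by
    refine (Matrix.l2_opNorm_mul _ _).trans ?_
    rw [Matrix.l2_opNorm_transpose]
    gcongr
  -- The bootstrap: replacing Z by Xh T and expanding Xh exposes D Y, whose rows are small; what
  -- remains is of second order in D.
  have hR2 : R = D * Y * (M * T) + D * R * T := by
    conv_lhs => rw [hR, hZT, hXh]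
    simp only [Matrix.mul_add, Matrix.add_mul, Matrix.mul_assoc]
  have hdec : Xh - Y * W = D * Y * (M * T) + D * R * T - Y * (J * R) + Y * (J * Xh - W) := by
    rw [← hR2, Matrix.mul_sub]
    have : Y * (J * Xh) = Y * M + Y * (J * R) := by
      conv_lhs => rw [hXh]
      rw [Matrix.mul_add, ← Matrix.mul_assoc J, hJ, Matrix.one_mul, Matrix.mul_add]
    rw [this, hXh]
    abel
  have hrowdec : WithLp.toLp 2 ((Xh - Y * W) i) = WithLp.toLp 2 ((D * Y * (M * T)) i)
      + WithLp.toLp 2 ((D * R * T) i) - WithLp.toLp 2 ((Y * (J * R)) i)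
      + WithLp.toLp 2 ((Y * (J * Xh - W)) i) := by
    rw [hdec]; rfl
  have b1 : ‖WithLp.toLp 2 ((D * Y * (M * T)) i)‖ ≤ κ * (y * z * t) := by
    refine (norm_row_mul_le _ _ i).trans ?_
    have hκ : 0 ≤ κ := (norm_nonneg _).trans (hrow i)
    gcongr
    · exact hrow i
    · exact (Matrix.l2_opNorm_mul _ _).trans (by gcongr)
  have b2 : ‖WithLp.toLp 2 ((D * R * T) i)‖ ≤ β * (β * z) * t := by
    refine (norm_row_le _ i).trans ((Matrix.l2_opNorm_mul _ _).trans ?_)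
    gcongr
    exact (Matrix.l2_opNorm_mul _ _).trans (by gcongr)
  have b3 : ‖WithLp.toLp 2 ((Y * (J * R)) i)‖ ≤ j * (β * z) := by
    refine (norm_row_mul_le _ _ i).trans ?_
    rw [← one_mul (j * (β * z))]
    gcongr
    · exact hYrow i
    · exact (Matrix.l2_opNorm_mul _ _).trans (by gcongr)
  have b4 : ‖WithLp.toLp 2 ((Y * (J * Xh - W)) i)‖ ≤ j * (2 * β) * j := by
    refine (norm_row_mul_le _ _ i).trans ?_
    rw [← one_mul (j * (2 * β) * j)]
    gcongr
    exact hYrow i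
  rw [hrowdec]
  refine (norm_add_le _ _).trans ?_
  refine add_le_add ((norm_sub_le _ _).trans (add_le_add ((norm_add_le _ _).trans
    (add_le_add b1 b2)) b3)) b4

end LinearAlgebra

/-! ### Spectral embeddings of a perturbed low-rank matrix. -/

section Embedding

open scoped Matrix.Norms.L2Operator

variable {n d : ℕ}

lemma dotProduct_conj_diagonal_mulVec (V : Matrix (Fin n) (Fin n) ℝ) (s v : Fin n → ℝ) :
    v ⬝ᵥ ((V * Matrix.diagonal s * Vᵀ) *ᵥ v) = ∑ j, s j * (Vᵀ *ᵥ v) j ^ 2 := by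
  rw [← Matrix.mulVec_mulVec, ← Matrix.mulVec_mulVec, Matrix.dotProduct_mulVec,
    ← Matrix.mulVec_transpose]
  simp only [dotProduct, Matrix.mulVec_diagonal]
  exact Finset.sum_congr rfl fun j _ => by ring

lemma dotProduct_self_eq_sum_transpose {V : Matrix (Fin n) (Fin n) ℝ} (hV : V * Vᵀ = 1)
    (v : Fin n → ℝ) : v ⬝ᵥ v = ∑ j, (Vᵀ *ᵥ v) j ^ 2 := by
  have := dotProduct_conj_diagonal_mulVec V (fun _ => 1) v
  rw [show Matrix.diagonal (fun _ : Fin n => (1 : ℝ)) = 1 from Matrix.diagonal_one, mul_one, hV,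
    Matrix.one_mulVec] at this
  simpa using this

/-- Eigenvalues past the `d`-th of a perturbation of `Y Yᵀ`, with `Y` of width `d`, are small. -/
lemma eigenvalue_le_of_rank {V : Matrix (Fin n) (Fin n) ℝ} (hV : V * Vᵀ = 1) {s : Fin n → ℝ}
    (hs : Antitone s) {Y : Matrix (Fin n) (Fin d) ℝ} {β : ℝ}
    (hβ : ‖V * Matrix.diagonal s * Vᵀ - Y * Yᵀ‖ ≤ β) {k : Fin n} (hk : d ≤ k) : s k ≤ β := by
  have hV' : Vᵀ * V = 1 := mul_eq_one_comm.mp hV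
  -- Dimension count: d + (n - 1 - k) < n linear conditions leave a nonzero combination of the first
  -- k + 1 eigenvectors that is annihilated by Yᵀ.
  let f : (Fin n → ℝ) →ₗ[ℝ] (Fin d → ℝ) × ({j : Fin n // k < j} → ℝ) :=
    (Matrix.mulVecLin (Yᵀ * V)).prod (LinearMap.funLeft ℝ ℝ Subtype.val)
  have hrank : Module.finrank ℝ ((Fin d → ℝ) × ({j : Fin n // k < j} → ℝ)) <
      Module.finrank ℝ (Fin n → ℝ) := by
    rw [Module.finrank_prod, Module.finrank_fin_fun, Module.finrank_fin_fun,
      Module.finrank_fintype_fun_eq_card, Fintype.card_subtype, Finset.filter_lt_eq_Ioi,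
      Fin.card_Ioi]
    omega
  obtain ⟨w, hw, hw0⟩ := (Submodule.ne_bot_iff _).mp (f.ker_ne_bot_of_finrank_lt hrank)
  rw [LinearMap.mem_ker] at hw
  have h1 : (Yᵀ * V) *ᵥ w = 0 := congrArg Prod.fst hw
  have h2 : LinearMap.funLeft ℝ ℝ (Subtype.val : {j : Fin n // k < j} → Fin n) w = 0 :=
    congrArg Prod.snd hw
  have h2' : ∀ j, k < j → w j = 0 := fun j hj => congrFun h2 ⟨j, hj⟩
  set v := V *ᵥ w with hv
  have hVv : Vᵀ *ᵥ v = w := by rw [hv, Matrix.mulVec_mulVec, hV', Matrix.one_mulVec]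
  have hYv : Yᵀ *ᵥ v = 0 := by rw [hv, Matrix.mulVec_mulVec, h1]
  have hb := (abs_le.mp (abs_dotProduct_mulVec_le (V * Matrix.diagonal s * Vᵀ - Y * Yᵀ) v)).2
  rw [Matrix.sub_mulVec, ← Matrix.mulVec_mulVec v Y, hYv, Matrix.mulVec_zero, sub_zero,
    dotProduct_conj_diagonal_mulVec, dotProduct_self_eq_sum_transpose hV, hVv] at hb
  have hpos : 0 < ∑ j, w j ^ 2 := by
    obtain ⟨j, hj⟩ := Function.ne_iff.mp hw0
    exact Finset.sum_pos' (fun _ _ => sq_nonneg _)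
      ⟨j, Finset.mem_univ j, sq_pos_of_ne_zero hj⟩
  have hlow : s k * ∑ j, w j ^ 2 ≤ ∑ j, s j * w j ^ 2 := by
    rw [Finset.mul_sum]
    refine Finset.sum_le_sum fun j _ => ?_
    rcases le_or_gt j k with hjk | hjk
    · exact mul_le_mul_of_nonneg_right (hs hjk) (sq_nonneg _)
    · simp [h2' j hjk]
  have : s k * ∑ j, w j ^ 2 ≤ β * ∑ j, w j ^ 2 :=
    hlow.trans (hb.trans (mul_le_mul_of_nonneg_right hβ hpos.le))
  exact le_of_mul_le_mul_right this hpos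

/-- The first `d` eigenvalues of a perturbation of `Y Yᵀ` are bounded below by the least
eigenvalue of `Yᵀ Y`. -/
lemma le_eigenvalue_of_gram {V : Matrix (Fin n) (Fin n) ℝ} (hV : V * Vᵀ = 1) {s : Fin n → ℝ}
    (hs : Antitone s) {Y : Matrix (Fin n) (Fin d) ℝ} {β lam : ℝ} (hlam : 0 < lam)
    (hG : ∀ u : Fin d → ℝ, lam * (u ⬝ᵥ u) ≤ u ⬝ᵥ ((Yᵀ * Y) *ᵥ u))
    (hβ : ‖V * Matrix.diagonal s * Vᵀ - Y * Yᵀ‖ ≤ β) {k : Fin n} (hk : k < d) :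
    lam - β ≤ s k := by
  -- Since k < d, the range of Y contains a nonzero Y u orthogonal to the first k eigenvectors.
  let f : (Fin d → ℝ) →ₗ[ℝ] ({j : Fin n // j < k} → ℝ) :=
    (LinearMap.funLeft ℝ ℝ Subtype.val).comp (Matrix.mulVecLin (Vᵀ * Y))
  have hrank : Module.finrank ℝ ({j : Fin n // j < k} → ℝ) < Module.finrank ℝ (Fin d → ℝ) := by
    rw [Module.finrank_fin_fun, Module.finrank_fintype_fun_eq_card, Fintype.card_subtype,
      Finset.filter_gt_eq_Iio, Fin.card_Iio]
    exact hk
  obtain ⟨u, hu, hu0⟩ := (Submodule.ne_bot_iff _).mp (f.ker_ne_bot_of_finrank_lt hrank)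
  rw [LinearMap.mem_ker] at hu
  have h2 : ∀ j, j < k → (Vᵀ *ᵥ (Y *ᵥ u)) j = 0 := by
    intro j hj
    rw [Matrix.mulVec_mulVec]
    exact congrFun hu ⟨j, hj⟩
  have hupos : 0 < u ⬝ᵥ u :=
    lt_of_le_of_ne (by rw [← norm_sq_toLp_eq_dotProduct]; positivity)
      (fun h => hu0 (dotProduct_self_eq_zero.mp h.symm))
  set v := Y *ᵥ u with hv
  have hvv : v ⬝ᵥ v = u ⬝ᵥ ((Yᵀ * Y) *ᵥ u) := by
    rw [← norm_sq_toLp_eq_dotProduct, hv, Matrix.norm_sq_toLp_mulVec]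
  have hvpos : 0 < v ⬝ᵥ v := by
    rw [hvv]; exact (mul_pos hlam hupos).trans_le (hG u)
  have hP : lam * (v ⬝ᵥ v) ≤ v ⬝ᵥ ((Y * Yᵀ) *ᵥ v) := by
    have e : v ⬝ᵥ ((Y * Yᵀ) *ᵥ v) = ‖WithLp.toLp 2 ((Yᵀ * Y) *ᵥ u)‖ ^ 2 := by
      rw [norm_sq_toLp_eq_dotProduct, ← Matrix.mulVec_mulVec, Matrix.dotProduct_mulVec,
        ← Matrix.mulVec_transpose, hv, Matrix.mulVec_mulVec]
    rw [e]
    -- With G = YᵀY and ‖v‖² = u·Gu, Cauchy–Schwarz gives ‖v‖⁴ ≤ ‖u‖²‖Gu‖²; combined with lam‖u‖² ≤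
    -- ‖v‖² this transfers the lower bound from G to Y Yᵀ on the range of Y.
    have hcs := (le_abs_self _).trans (abs_dotProduct_le_norm u ((Yᵀ * Y) *ᵥ u))
    rw [← hvv] at hcs
    have hsq : (v ⬝ᵥ v) ^ 2 ≤ (u ⬝ᵥ u) * ‖WithLp.toLp 2 ((Yᵀ * Y) *ᵥ u)‖ ^ 2 := by
      rw [← norm_sq_toLp_eq_dotProduct u, ← mul_pow]
      gcongr
    have hg := hG u
    rw [← hvv] at hg
    have : (v ⬝ᵥ v) * (lam * (v ⬝ᵥ v)) ≤ (v ⬝ᵥ v) * ‖WithLp.toLp 2 ((Yᵀ * Y) *ᵥ u)‖ ^ 2 := by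
      calc (v ⬝ᵥ v) * (lam * (v ⬝ᵥ v)) = lam * (v ⬝ᵥ v) ^ 2 := by ring
        _ ≤ lam * ((u ⬝ᵥ u) * ‖WithLp.toLp 2 ((Yᵀ * Y) *ᵥ u)‖ ^ 2) := by gcongr
        _ = (lam * (u ⬝ᵥ u)) * ‖WithLp.toLp 2 ((Yᵀ * Y) *ᵥ u)‖ ^ 2 := by ring
        _ ≤ _ := by gcongr
    exact le_of_mul_le_mul_left this hvpos
  have hb := (abs_le.mp (abs_dotProduct_mulVec_le (V * Matrix.diagonal s * Vᵀ - Y * Yᵀ) v)).1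
  rw [Matrix.sub_mulVec, dotProduct_sub, dotProduct_conj_diagonal_mulVec] at hb
  have hup : ∑ j, s j * (Vᵀ *ᵥ v) j ^ 2 ≤ s k * (v ⬝ᵥ v) := by
    rw [dotProduct_self_eq_sum_transpose hV, Finset.mul_sum]
    refine Finset.sum_le_sum fun j _ => ?_
    rcases le_or_gt k j with hjk | hjk
    · exact mul_le_mul_of_nonneg_right (hs hjk) (sq_nonneg _)
    · simp [h2 j hjk]
  have hβ' := mul_le_mul_of_nonneg_right hβ hvpos.le
  have : (lam - β) * (v ⬝ᵥ v) ≤ s k * (v ⬝ᵥ v) := by linarith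
  exact le_of_mul_le_mul_right this hvpos

lemma sum_castLE_eq (h : d ≤ n) (f : Fin n → ℝ) :
    ∑ k : Fin d, f (Fin.castLE h k) = ∑ j : Fin n, if (j : ℕ) < d then f j else 0 := by
  rw [← Finset.sum_filter]
  refine Finset.sum_nbij (Fin.castLE h) (by simp) (Fin.castLE_injective h).injOn
    (fun j hj => ?_) (fun _ _ => rfl)
  simp only [Finset.coe_filter, Finset.mem_univ, true_and, Set.mem_ofPred_eq] at hj
  exact ⟨⟨j, hj⟩, by simp, by ext; simp⟩

lemma nonneg_of_matrixAbs_eq {A V : Matrix (Fin n) (Fin n) ℝ} {s : Fin n → ℝ} (hV : Vᵀ * V = 1)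
    (hVs : matrixAbs A = V * Matrix.diagonal s * Vᵀ) (j : Fin n) : 0 ≤ s j := by
  have hpsd : (matrixAbs A).PosSemidef := Matrix.nonneg_iff_posSemidef.mp (CFC.sqrt_nonneg _)
  have h1 := hpsd.conjTranspose_mul_mul_same V
  rw [Matrix.conjTranspose_eq_transpose_of_trivial, hVs,
    show Vᵀ * (V * Matrix.diagonal s * Vᵀ) * V = (Vᵀ * V) * Matrix.diagonal s * (Vᵀ * V) by
      simp only [Matrix.mul_assoc], hV, Matrix.one_mul, Matrix.mul_one,
    Matrix.posSemidef_diagonal_iff] at h1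
  exact h1 j

/-- Rowwise error of a spectral embedding of a symmetric matrix `A` close to `Y Yᵀ`. -/
lemma ase_row_bound {A : Matrix (Fin n) (Fin n) ℝ} (hA : A.IsHermitian)
    {Y Xh : Matrix (Fin n) (Fin d) ℝ} (hXh : IsASE A fun i => WithLp.toLp 2 (Xh i))
    {lam y σ τ : ℝ} (hlam : 0 < lam)
    (hG : ∀ u : Fin d → ℝ, lam * (u ⬝ᵥ u) ≤ u ⬝ᵥ ((Yᵀ * Y) *ᵥ u))
    (hY : ‖Y‖ ≤ y) (hYrow : ∀ i, ‖WithLp.toLp 2 (Y i)‖ ≤ 1)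
    (hσ : ‖A - Y * Yᵀ‖ ≤ σ) (hσlam : 6 * σ ≤ lam)
    (hτ : ∀ i, ‖WithLp.toLp 2 (((A - Y * Yᵀ) * Y) i)‖ ≤ τ)
    (hsmall : y / lam * (2 * (3 * σ)) * (y / lam) < 1) :
    ∃ W ∈ Matrix.orthogonalGroup (Fin d) ℝ, ∀ i,
      ‖WithLp.toLp 2 ((Xh - Y * W) i)‖ ≤
        (τ + 4 * σ ^ 2 * (y / lam)) * (y * √(2 / lam) * (2 / lam))
          + 3 * σ * (3 * σ * √(2 / lam)) * (2 / lam) + y / lam * (3 * σ * √(2 / lam))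
          + y / lam * (2 * (3 * σ)) * (y / lam) := by
  have hσ0 : 0 ≤ σ := (norm_nonneg _).trans hσ
  have hy0 : 0 ≤ y := (norm_nonneg _).trans hY
  have hPpsd : (Y * Yᵀ).PosSemidef := by
    simpa using Matrix.posSemidef_self_mul_conjTranspose Y
  obtain ⟨N, hN, hNσ, hNP⟩ := exists_matrixAbs_eq_add hA hPpsd hσ
  obtain ⟨hdn, V, s, hVo, hs, hVs, hXV⟩ := hXh
  have hV : V * Vᵀ = 1 := (Matrix.mem_orthogonalGroup_iff _ _).mp hVo
  have hV' : Vᵀ * V = 1 := mul_eq_one_comm.mp hV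
  have hVnorm : ‖V‖ ≤ 1 := l2_opNorm_le_one_of_transpose_mul_self hV'
  -- One σ from A and two from 2N. With 6σ ≤ lam the leading eigenvalues then stay above lam / 2.
  have hB : ‖matrixAbs A - Y * Yᵀ‖ ≤ 3 * σ := by
    rw [hN, show A + 2 • N - Y * Yᵀ = (A - Y * Yᵀ) + (N + N) by rw [two_smul]; abel]
    refine (norm_add_le _ _).trans ?_
    have := norm_add_le N N
    linarith
  have hs0 : ∀ j, 0 ≤ s j := nonneg_of_matrixAbs_eq hV' hVs
  have hB' := hB
  rw [hVs] at hB'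
  have hshigh : ∀ k : Fin n, (k : ℕ) < d → lam / 2 ≤ s k := fun k hk => by
    have := le_eigenvalue_of_gram hV hs hlam hG hB' hk
    linarith
  have hslow : ∀ k : Fin n, d ≤ k → s k ≤ 3 * σ := fun k hk => eigenvalue_le_of_rank hV hs hB' hk
  set e : Fin d → Fin n := Fin.castLE hdn with he
  have hse : ∀ k, lam / 2 ≤ s (e k) := fun k => hshigh _ (by simp [he])
  have hsepos : ∀ k, 0 < s (e k) := fun k => (half_pos hlam).trans_le (hse k)
  set U : Matrix (Fin n) (Fin d) ℝ := V.submatrix id e with hU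
  have hUnorm : ‖U‖ ≤ 1 := by
    refine l2_opNorm_le_one_of_transpose_mul_self ?_
    ext k l
    have := congrFun (congrFun hV' (e k)) (e l)
    rw [Matrix.mul_apply] at this ⊢
    simpa [hU, Matrix.one_apply, he] using this
  have hXhU : Xh = U * Matrix.diagonal (fun k => √(s (e k))) := by
    ext i k
    rw [Matrix.mul_diagonal]
    exact hXV i k
  have hBU : matrixAbs A * U = U * Matrix.diagonal (fun k => s (e k)) := by
    have h1 : matrixAbs A * V = V * Matrix.diagonal s := by
      rw [hVs, Matrix.mul_assoc, hV', Matrix.mul_one]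
    ext i k
    have := congrFun (congrFun h1 i) (e k)
    rw [Matrix.mul_diagonal] at this ⊢
    exact this
  -- Z = U S^(-1/2) and T = S⁻¹, so that |A| Z = Xh and Z = Xh T.
  set Z := U * Matrix.diagonal (fun k => (√(s (e k)))⁻¹) with hZ
  set T := Matrix.diagonal (fun k => (s (e k))⁻¹) with hT
  have hBZ : matrixAbs A * Z = Xh := by
    rw [hZ, ← Matrix.mul_assoc, hBU, Matrix.mul_assoc, Matrix.diagonal_mul_diagonal, hXhU]
    congr 2
    funext k
    rw [← div_eq_mul_inv, Real.div_sqrt]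
  have hZT : Z = Xh * T := by
    rw [hZ, hXhU, hT, Matrix.mul_assoc, Matrix.diagonal_mul_diagonal]
    congr 2
    funext k
    rw [← div_eq_mul_inv, Real.sqrt_div_self', one_div]
  have hZnorm : ‖Z‖ ≤ √(2 / lam) := by
    refine (Matrix.l2_opNorm_mul _ _).trans ?_
    rw [Matrix.l2_opNorm_diagonal, ← one_mul √(2 / lam)]
    gcongr
    refine (pi_norm_le_iff_of_nonneg (Real.sqrt_nonneg _)).mpr fun k => ?_
    rw [Real.norm_of_nonneg (by positivity), ← Real.sqrt_inv]
    refine Real.sqrt_le_sqrt ?_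
    rw [← inv_div]
    exact inv_anti₀ (by positivity) (hse k)
  have hTnorm : ‖T‖ ≤ 2 / lam := by
    rw [hT, Matrix.l2_opNorm_diagonal]
    refine (pi_norm_le_iff_of_nonneg (by positivity)).mpr fun k => ?_
    rw [Real.norm_of_nonneg (inv_nonneg.mpr (hsepos k).le), ← inv_div]
    exact inv_anti₀ (by positivity) (hse k)
  -- Xh Xhᵀ is |A| with the eigenvalues past the d-th removed; those are at most 3σ.
  have hXX : ‖Xh * Xhᵀ - Y * Yᵀ‖ ≤ 2 * (3 * σ) := by
    have e1 : matrixAbs A - Xh * Xhᵀ =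
        V * Matrix.diagonal (fun j : Fin n => if (j : ℕ) < d then 0 else s j) * Vᵀ := by
      have e2 : Xh * Xhᵀ =
          V * Matrix.diagonal (fun j : Fin n => if (j : ℕ) < d then s j else 0) * Vᵀ := by
        ext i l
        have h3 := sum_castLE_eq hdn fun j => V i j * s j * V l j
        rw [Matrix.mul_apply, Matrix.mul_apply, hXhU]
        simp only [Matrix.transpose_apply, Matrix.mul_diagonal]
        simp only [hU, Matrix.submatrix_apply, id_eq]
        trans ∑ k, V i (e k) * s (e k) * V l (e k)
        · refine Finset.sum_congr rfl fun k _ => ?_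
          have := Real.mul_self_sqrt (hs0 (e k))
          linear_combination V i (e k) * V l (e k) * this
        · rw [h3]
          refine Finset.sum_congr rfl fun j _ => ?_
          split_ifs <;> simp
      rw [e2, hVs, ← Matrix.sub_mul, ← Matrix.mul_sub, Matrix.diagonal_sub]
      congr 3
      funext j
      split_ifs <;> simp
    have e3 : ‖matrixAbs A - Xh * Xhᵀ‖ ≤ 3 * σ := by
      rw [e1]
      refine (Matrix.l2_opNorm_mul _ _).trans ?_
      rw [Matrix.l2_opNorm_transpose]
      have h4 : ‖Matrix.diagonal (fun j : Fin n => if (j : ℕ) < d then 0 else s j)‖ ≤ 3 * σ := by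
        rw [Matrix.l2_opNorm_diagonal]
        refine (pi_norm_le_iff_of_nonneg (by positivity)).mpr fun k => ?_
        split_ifs with hk
        · simpa using hσ0
        · rw [Real.norm_of_nonneg (hs0 k)]
          exact hslow k (not_lt.mp hk)
      have h5 := Matrix.l2_opNorm_mul V
        (Matrix.diagonal fun j : Fin n => if (j : ℕ) < d then 0 else s j)
      calc _ ≤ (1 * (3 * σ)) * 1 := by
            gcongr
            exact h5.trans (by gcongr)
        _ = 3 * σ := by ring
    rw [show Xh * Xhᵀ - Y * Yᵀ = (matrixAbs A - Y * Yᵀ) - (matrixAbs A - Xh * Xhᵀ) by abel]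
    refine (norm_sub_le _ _).trans ?_
    linarith
  set G := Yᵀ * Y with hGdef
  have hGdet : IsUnit G.det := by
    rw [isUnit_iff_ne_zero]
    intro h0
    obtain ⟨u, hu, hu'⟩ := Matrix.exists_mulVec_eq_zero_iff.mpr h0
    have h1 := hG u
    rw [hu', dotProduct_zero] at h1
    have h2 : 0 ≤ u ⬝ᵥ u := by rw [← norm_sq_toLp_eq_dotProduct]; positivity
    exact hu (dotProduct_self_eq_zero.mp (by nlinarith))
  have hGinv : ‖G⁻¹‖ ≤ 1 / lam := by
    refine Matrix.l2_opNorm_le_of_mulVec (by positivity) fun v => ?_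
    set w := G⁻¹ *ᵥ v.ofLp with hw
    have hGw : G *ᵥ w = v.ofLp := by
      rw [hw, Matrix.mulVec_mulVec, Matrix.mul_nonsing_inv _ hGdet, Matrix.one_mulVec]
    have h1 := hG w
    rw [hGw] at h1
    have h2 := h1.trans ((le_abs_self _).trans (abs_dotProduct_le_norm w v.ofLp))
    rw [← norm_sq_toLp_eq_dotProduct] at h2
    rw [div_mul_eq_mul_div, one_mul, le_div_iff₀ hlam]
    rcases (norm_nonneg (WithLp.toLp 2 w)).eq_or_lt with h0 | h0
    · rw [← h0]; simp
    · refine le_of_mul_le_mul_left (le_trans (le_of_eq ?_) h2) h0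
      ring
  have hJ : G⁻¹ * Yᵀ * Y = 1 := by
    rw [Matrix.mul_assoc, ← hGdef, Matrix.nonsing_inv_mul _ hGdet]
  have hJnorm : ‖G⁻¹ * Yᵀ‖ ≤ y / lam := by
    refine (Matrix.l2_opNorm_mul _ _).trans ?_
    rw [Matrix.l2_opNorm_transpose, div_eq_mul_one_div, mul_comm]
    gcongr
  -- Y = (Y Yᵀ)(Y G⁻¹), so the quadratic bound on N Y Yᵀ applies; the bound σ y from ‖N‖ alone would
  -- be too weak.
  have hNY : ‖N * Y‖ ≤ 2 * σ ^ 2 * (y / lam) := by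
    have e1 : N * Y = N * (Y * Yᵀ) * (Y * G⁻¹) := by
      rw [Matrix.mul_assoc, show Y * Yᵀ * (Y * G⁻¹) = Y * (G * G⁻¹) by
        rw [hGdef]; simp only [Matrix.mul_assoc], Matrix.mul_nonsing_inv _ hGdet, Matrix.mul_one]
    rw [e1]
    refine (Matrix.l2_opNorm_mul _ _).trans ?_
    rw [div_eq_mul_one_div]
    gcongr
    exact (Matrix.l2_opNorm_mul _ _).trans (by gcongr)
  have hrow : ∀ i, ‖WithLp.toLp 2 (((matrixAbs A - Y * Yᵀ) * Y) i)‖ ≤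
      τ + 4 * σ ^ 2 * (y / lam) := by
    intro i
    have e1 : (matrixAbs A - Y * Yᵀ) * Y = (A - Y * Yᵀ) * Y + (N * Y + N * Y) := by
      rw [hN, two_smul]
      simp only [Matrix.sub_mul, Matrix.add_mul]
      abel
    have e2 : WithLp.toLp 2 (((matrixAbs A - Y * Yᵀ) * Y) i) =
        WithLp.toLp 2 (((A - Y * Yᵀ) * Y) i) + WithLp.toLp 2 ((N * Y + N * Y) i) := by
      rw [e1]; rfl
    rw [e2]
    refine (norm_add_le _ _).trans (add_le_add (hτ i) ((norm_row_le _ i).trans ?_))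
    have := norm_add_le (N * Y) (N * Y)
    linarith
  exact exists_orthogonal_row_bound hBZ hZT hJ hB hXX hY hZnorm hTnorm hJnorm hrow hYrow hsmall

end Embedding

/-! ### Mixed moments of independent centered Bernoulli variables. -/

section BernoulliProduct

variable {ι : Type*} [Fintype ι]

/-- The probability that independent Bernoulli variables with parameters `p` take the values `g`. -/
def bernoulliWeight (p : ι → ℝ) (g : ι → Bool) : ℝ :=
  ∏ e, if g e then p e else 1 - p e

/-- The centered value of the Bernoulli variable indexed by `e`. -/
def centeredBit (p : ι → ℝ) (g : ι → Bool) (e : ι) : ℝ :=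
  (if g e then 1 else 0) - p e

lemma bernoulliWeight_nonneg {p : ι → ℝ} (hp : ∀ e, p e ∈ Set.Icc (0 : ℝ) 1) (g : ι → Bool) :
    0 ≤ bernoulliWeight p g := by
  refine Finset.prod_nonneg fun e _ => ?_
  have := hp e
  split_ifs
  · exact this.1
  · exact sub_nonneg.mpr this.2

lemma sum_bernoulliWeight_mul_prod [DecidableEq ι] (p : ι → ℝ) (h : ι → Bool → ℝ) :
    ∑ g, bernoulliWeight p g * ∏ e, h e (g e) =
      ∏ e, (p e * h e true + (1 - p e) * h e false) := by
  have := Finset.prod_univ_sum (fun _ : ι => (Finset.univ : Finset Bool))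
    (fun e b => (if b then p e else 1 - p e) * h e b)
  simp only [Fintype.sum_bool, if_true, Bool.false_eq_true, if_false, Fintype.piFinset_univ] at this
  rw [this]
  refine Finset.sum_congr rfl fun g _ => ?_
  rw [bernoulliWeight, ← Finset.prod_mul_distrib]

/-- The centered variable is bounded by 1, so its higher moments are dominated by the variance p(1 -
p) ≤ p. -/
lemma abs_centered_moment_le {p ρ : ℝ} (hp : p ∈ Set.Icc (0 : ℝ) 1) (hρ : p ≤ ρ) {m : ℕ}
    (hm : 2 ≤ m) : |p * (1 - p) ^ m + (1 - p) * (-p) ^ m| ≤ ρ := by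
  obtain ⟨h0, h1⟩ := hp
  have h1' : 0 ≤ 1 - p := by linarith
  obtain ⟨l, rfl⟩ : ∃ l, m = l + 2 := ⟨m - 2, by omega⟩
  have e1 : (1 - p) ^ (l + 2) ≤ (1 - p) ^ 2 :=
    pow_le_pow_of_le_one h1' (by linarith) (show 2 ≤ l + 2 by omega)
  have e2 : p ^ (l + 2) ≤ p ^ 2 := pow_le_pow_of_le_one h0 h1 (show 2 ≤ l + 2 by omega)
  calc _ ≤ |p * (1 - p) ^ (l + 2)| + |(1 - p) * (-p) ^ (l + 2)| := abs_add_le _ _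
    _ = p * (1 - p) ^ (l + 2) + (1 - p) * p ^ (l + 2) := by
        rw [abs_mul, abs_mul, abs_pow, abs_pow, abs_neg, abs_of_nonneg h0, abs_of_nonneg h1']
    _ ≤ p * (1 - p) ^ 2 + (1 - p) * p ^ 2 := by gcongr
    _ = p - p ^ 2 := by ring
    _ ≤ ρ := by nlinarith [sq_nonneg p]

/-- A mixed moment of even order of centered Bernoulli variables vanishes if some variable occurs
exactly once, and is at most `ρ` to the number of variables that occur otherwise. -/
lemma abs_mixed_moment_le [DecidableEq ι] {p : ι → ℝ} (hp : ∀ e, p e ∈ Set.Icc (0 : ℝ) 1)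
    {ρ z : ℝ} (hρ0 : 0 ≤ ρ) (hρ : ∀ e, p e ≤ ρ) (hz0 : 0 < z) (hz1 : z ≤ 1) {k : ℕ}
    (f : Fin (2 * k) → ι) :
    |∑ g, bernoulliWeight p g * ∏ s, centeredBit p g (f s)| ≤
      (z ^ k)⁻¹ * (ρ * z) ^ (Finset.univ.image f).card := by
  set cnt : ι → ℕ := fun a => (Finset.univ.filter fun s => f s = a).card with hcnt
  have h1 : ∀ g, ∏ s, centeredBit p g (f s) = ∏ a, centeredBit p g a ^ cnt a := by
    intro g
    rw [← Finset.prod_fiberwise' Finset.univ f (centeredBit p g)]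
    exact Finset.prod_congr rfl fun a _ => Finset.prod_const _
  have h2 : ∑ g, bernoulliWeight p g * ∏ s, centeredBit p g (f s) =
      ∏ a, (p a * (1 - p a) ^ cnt a + (1 - p a) * (-p a) ^ cnt a) := by
    have := sum_bernoulliWeight_mul_prod p
      (fun a b => ((if b then 1 else 0) - p a) ^ cnt a)
    simp only [if_true, Bool.false_eq_true, if_false, zero_sub] at this
    rw [← this]
    exact Finset.sum_congr rfl fun g _ => by rw [h1]; rfl
  rw [h2]
  by_cases hone : ∃ a, cnt a = 1
  · obtain ⟨a, ha⟩ := hone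
    rw [Finset.prod_eq_zero (Finset.mem_univ a) (by rw [ha]; ring), abs_zero]
    positivity
  · push Not at hone
    have hmem : ∀ a, a ∈ Finset.univ.image f ↔ cnt a ≠ 0 := by
      intro a
      rw [hcnt, Finset.card_ne_zero, Finset.filter_nonempty_iff]
      simp
    have h3 : |∏ a, (p a * (1 - p a) ^ cnt a + (1 - p a) * (-p a) ^ cnt a)| ≤
        ρ ^ (Finset.univ.image f).card := by
      rw [Finset.abs_prod]
      calc _ ≤ ∏ a, (if a ∈ Finset.univ.image f then ρ else 1) := by
            refine Finset.prod_le_prod (fun _ _ => abs_nonneg _) fun a _ => ?_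
            split_ifs with ha
            · refine abs_centered_moment_le (hp a) (hρ a) ?_
              have := (hmem a).mp ha
              have := hone a
              omega
            · have : cnt a = 0 := by simpa using mt (hmem a).mpr ha
              rw [this]; simp
        _ = _ := by rw [Finset.prod_ite_mem, Finset.univ_inter, Finset.prod_const]
    have hcard : (Finset.univ.image f).card ≤ k := by
      have := Finset.mul_card_image_le_card (f := f) Finset.univ 2 (fun a ha => by
        have := (hmem a).mp ha
        have := hone a
        change 2 ≤ cnt a
        omega)
      rw [Finset.card_univ, Fintype.card_fin] at this
      omega
    -- At most k variables occur, so the factor z^(card - k) is at least 1. Inserting it lets the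
    -- later sum run over all walks without a constraint on the number of edges.
    refine h3.trans ?_
    rw [mul_pow, ← mul_assoc, mul_comm _ (ρ ^ _), mul_assoc]
    refine le_mul_of_one_le_right (by positivity) ?_
    rw [inv_mul_eq_div, one_le_div (by positivity)]
    exact pow_le_pow_of_le_one hz0.le hz1 hcard

end BernoulliProduct

/-! ### The trace method: walks and their edges. -/

section Walks

variable {n : ℕ}

lemma sum_fin_succ_fun {M : Type*} [AddCommMonoid M] (m : ℕ) (f : (Fin (m + 1) → Fin n) → M) :
    ∑ w, f w = ∑ w : Fin m → Fin n, ∑ v : Fin n, f (Fin.snoc w v) := by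
  rw [← (Fin.snocEquiv fun _ => Fin n).sum_comp, Fintype.sum_prod_type_right]
  rfl

/-- The endpoints are imposed by an indicator on all vertex sequences, so that the constraint can be
dropped in upper bounds. -/
lemma Matrix.pow_apply_eq_sum_walks (B : Matrix (Fin n) (Fin n) ℝ) (m : ℕ) (i j : Fin n) :
    (B ^ m) i j = ∑ w : Fin (m + 1) → Fin n, if w 0 = i ∧ w (Fin.last m) = j then
      ∏ s : Fin m, B (w s.castSucc) (w s.succ) else 0 := by
  induction m generalizing j with
  | zero =>
    rw [sum_fin_succ_fun]
    simp only [pow_zero, Matrix.one_apply, Finset.univ_unique, Finset.sum_singleton,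
      Finset.univ_eq_empty, Finset.prod_empty]
    have : ∀ v : Fin n, (Fin.snoc (default : Fin 0 → Fin n) v : Fin 1 → Fin n) = fun _ => v := by
      intro v
      funext s
      rw [show s = Fin.last 0 from Fin.ext (by omega), Fin.snoc_last]
    simp only [this]
    by_cases h : i = j
    · subst h
      simp
    · rw [if_neg h, Finset.sum_eq_zero]
      rintro v -
      rw [if_neg]
      rintro ⟨rfl, rfl⟩
      exact h rfl
  | succ m ih =>
    rw [pow_succ, Matrix.mul_apply, sum_fin_succ_fun]
    simp only [ih, Finset.sum_mul]
    rw [Finset.sum_comm]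
    refine Finset.sum_congr rfl fun w _ => ?_
    have e1 : ∀ v : Fin n, (Fin.snoc w v : Fin (m + 2) → Fin n) 0 = w 0 := by
      intro v
      rw [← Fin.castSucc_zero, Fin.snoc_castSucc]
    simp only [e1, Fin.snoc_last, Fin.prod_univ_castSucc, Fin.snoc_castSucc, Fin.succ_last,
      ← Fin.castSucc_succ]
    rw [Finset.sum_eq_single (w (Fin.last m)), Finset.sum_eq_single j]
    · simp [ite_mul]
    · intro v _ hv
      rw [if_neg (fun h => hv h.2)]
    · simp
    · intro l _ hl
      rw [if_neg (fun h => hl h.2.symm), zero_mul]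
    · simp

/-- The unordered pairs traversed by a walk. -/
def walkEdges {m : ℕ} (w : Fin (m + 1) → Fin n) : Finset (Fin n × Fin n) :=
  Finset.univ.image fun s : Fin m =>
    (min (w s.castSucc) (w s.succ), max (w s.castSucc) (w s.succ))

lemma walkEdges_snoc {m : ℕ} (w : Fin (m + 1) → Fin n) (v : Fin n) :
    walkEdges (Fin.snoc w v : Fin (m + 2) → Fin n) =
      insert (min (w (Fin.last m)) v, max (w (Fin.last m)) v) (walkEdges w) := by
  ext a
  simp only [walkEdges, Finset.mem_image, Finset.mem_univ, true_and, Finset.mem_insert]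
  constructor
  · rintro ⟨s, rfl⟩
    induction s using Fin.lastCases with
    | last => left; simp only [Fin.snoc_castSucc, Fin.succ_last, Fin.snoc_last]
    | cast s =>
      right
      exact ⟨s, by simp only [← Fin.castSucc_succ, Fin.snoc_castSucc]⟩
  · rintro (rfl | ⟨s, rfl⟩)
    · exact ⟨Fin.last m, by simp only [Fin.snoc_castSucc, Fin.succ_last, Fin.snoc_last]⟩
    · exact ⟨s.castSucc, by simp only [← Fin.castSucc_succ, Fin.snoc_castSucc]⟩

/-- Walks are extended one vertex at a time. A vertex not yet visited forces a new edge and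
contributes a factor y, for at most n choices; a visited vertex contributes a factor at most 1, for
at most l + 1 choices at stage l. -/
lemma sum_pow_card_walkEdges_le {y : ℝ} (hy0 : 0 ≤ y) (hy1 : y ≤ 1) (m : ℕ) :
    ∑ w : Fin (m + 1) → Fin n, y ^ (walkEdges w).card ≤
      n * ∏ l ∈ Finset.range m, (n * y + (l + 1)) := by
  induction m with
  | zero => simp [walkEdges]
  | succ m ih =>
    rw [sum_fin_succ_fun, Finset.prod_range_succ, ← mul_assoc]
    refine le_trans ?_ (mul_le_mul_of_nonneg_right ih (by positivity))
    rw [Finset.sum_mul]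
    refine Finset.sum_le_sum fun w _ => ?_
    set V := Finset.univ.image w with hV
    have hbd : ∀ v, y ^ (walkEdges (Fin.snoc w v : Fin (m + 2) → Fin n)).card ≤
        y ^ (walkEdges w).card * (y + if v ∈ V then 1 else 0) := by
      intro v
      split_ifs with hv
      · have : (walkEdges w).card ≤ (walkEdges (Fin.snoc w v : Fin (m + 2) → Fin n)).card := by
          rw [walkEdges_snoc]
          exact Finset.card_le_card (Finset.subset_insert _ _)
        calc _ ≤ y ^ (walkEdges w).card := pow_le_pow_of_le_one hy0 hy1 this
          _ ≤ _ := le_mul_of_one_le_right (by positivity) (by linarith)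
      · have : (walkEdges (Fin.snoc w v : Fin (m + 2) → Fin n)).card = (walkEdges w).card + 1 := by
          rw [walkEdges_snoc, Finset.card_insert_of_notMem]
          intro hmem
          simp only [walkEdges, Finset.mem_image, Finset.mem_univ, true_and, Prod.mk.injEq] at hmem
          obtain ⟨s, h1, h2⟩ := hmem
          apply hv
          rw [hV, Finset.mem_image]
          rcases le_total (w (Fin.last m)) v with h | h
          · rw [max_eq_right h] at h2
            rcases max_choice (w s.castSucc) (w s.succ) with h3 | h3
            · exact ⟨_, Finset.mem_univ _, h3.symm.trans h2⟩
            · exact ⟨_, Finset.mem_univ _, h3.symm.trans h2⟩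
          · rw [min_eq_right h] at h1
            rcases min_choice (w s.castSucc) (w s.succ) with h3 | h3
            · exact ⟨_, Finset.mem_univ _, h3.symm.trans h1⟩
            · exact ⟨_, Finset.mem_univ _, h3.symm.trans h1⟩
        rw [this, pow_succ, add_zero]
    refine (Finset.sum_le_sum fun v _ => hbd v).trans ?_
    rw [← Finset.mul_sum]
    gcongr
    rw [Finset.sum_add_distrib, Finset.sum_const, Finset.card_univ, Fintype.card_fin, nsmul_eq_mul]
    gcongr
    rw [Finset.sum_boole]
    have : V.card ≤ m + 1 := by
      simpa using Finset.card_image_le (s := (Finset.univ : Finset (Fin (m + 1)))) (f := w)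
    rw [Finset.filter_mem_eq_inter, Finset.univ_inter]
    exact_mod_cast this

/-- Edges of the complete graph on `Fin n`, as increasing pairs. -/
abbrev EdgeIdx (n : ℕ) : Type := {p : Fin n × Fin n // p.1 < p.2}

/-- The symmetric matrix with zero diagonal and off-diagonal entries `c`. -/
def hollowMatrix (c : EdgeIdx n → ℝ) : Matrix (Fin n) (Fin n) ℝ :=
  Matrix.of fun i j => if h : i ≠ j then c ⟨(min i j, max i j), min_lt_max.mpr h⟩ else 0

lemma hollowMatrix_apply_of_ne (c : EdgeIdx n → ℝ) {i j : Fin n} (h : i ≠ j) :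
    hollowMatrix c i j = c ⟨(min i j, max i j), min_lt_max.mpr h⟩ := by
  simp only [hollowMatrix, Matrix.of_apply]
  rw [dif_pos h]

lemma hollowMatrix_apply_self (c : EdgeIdx n → ℝ) (i : Fin n) : hollowMatrix c i i = 0 := by
  simp [hollowMatrix]

lemma hollowMatrix_apply_of_lt (c : EdgeIdx n → ℝ) {i j : Fin n} (h : i < j) :
    hollowMatrix c i j = c ⟨(i, j), h⟩ := by
  rw [hollowMatrix_apply_of_ne c h.ne]
  congr 3
  · exact min_eq_left h.le
  · exact max_eq_right h.le

lemma hollowMatrix_symm (c : EdgeIdx n → ℝ) (i j : Fin n) :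
    hollowMatrix c i j = hollowMatrix c j i := by
  by_cases h : i = j
  · rw [h]
  · rw [hollowMatrix_apply_of_ne c h, hollowMatrix_apply_of_ne c (Ne.symm h)]
    congr 3
    · exact min_comm i j
    · exact max_comm i j

lemma abs_walk_moment_le {p : EdgeIdx n → ℝ} (hp : ∀ e, p e ∈ Set.Icc (0 : ℝ) 1)
    {ρ z : ℝ} (hρ0 : 0 ≤ ρ) (hρ : ∀ e, p e ≤ ρ) (hz0 : 0 < z) (hz1 : z ≤ 1) {k : ℕ}
    (w : Fin (2 * k + 1) → Fin n) :
    |∑ g, bernoulliWeight p g *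
        ∏ s : Fin (2 * k), hollowMatrix (centeredBit p g) (w s.castSucc) (w s.succ)| ≤
      (z ^ k)⁻¹ * (ρ * z) ^ (walkEdges w).card := by
  by_cases hloop : ∃ s : Fin (2 * k), w s.castSucc = w s.succ
  · obtain ⟨s, hs⟩ := hloop
    rw [Finset.sum_eq_zero, abs_zero]
    · positivity
    · intro g _
      rw [Finset.prod_eq_zero (Finset.mem_univ s) (by rw [hs, hollowMatrix_apply_self]), mul_zero]
  · push Not at hloop
    set f : Fin (2 * k) → EdgeIdx n := fun s =>
      ⟨(min (w s.castSucc) (w s.succ), max (w s.castSucc) (w s.succ)),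
        min_lt_max.mpr (hloop s)⟩ with hf
    have hcard : (walkEdges w).card = (Finset.univ.image f).card := by
      rw [← Finset.card_image_of_injective _ Subtype.val_injective, Finset.image_image]
      rfl
    have h1 : ∀ g, ∏ s : Fin (2 * k), hollowMatrix (centeredBit p g) (w s.castSucc) (w s.succ) =
        ∏ s, centeredBit p g (f s) := fun g =>
      Finset.prod_congr rfl fun s _ => hollowMatrix_apply_of_ne _ (hloop s)
    simp only [h1, hcard]
    exact abs_mixed_moment_le hp hρ0 hρ hz0 hz1 f

/-- The expected trace of an even power of the centered adjacency matrix of a random graph. -/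
lemma sum_bernoulliWeight_mul_trace_le {p : EdgeIdx n → ℝ} (hp : ∀ e, p e ∈ Set.Icc (0 : ℝ) 1)
    {ρ : ℝ} (hρ1 : ρ ≤ 1) (hρ : ∀ e, p e ≤ ρ) {k : ℕ} (hk : 0 < k) (hkn : 2 * k ≤ n * ρ) :
    ∑ g, bernoulliWeight p g * (hollowMatrix (centeredBit p g) ^ (2 * k)).trace ≤
      n * (8 * k * (n * ρ)) ^ k := by
  have hk' : (0 : ℝ) < k := by exact_mod_cast hk
  have hnρ : (0 : ℝ) < n * ρ := by linarith
  have hn0 : (0 : ℝ) < n := by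
    rcases (Nat.cast_nonneg (α := ℝ) n).eq_or_lt with h | h
    · rw [← h] at hnρ; simp at hnρ
    · exact h
  have hρ0 : 0 < ρ := pos_of_mul_pos_right hnρ hn0.le
  -- This balances the two kinds of extension: n ρ z = 2k, which also bounds the number of visited
  -- vertices. Each step then costs at most 4k, and (4k)² / z = 8k n ρ.
  set z : ℝ := 2 * k / (n * ρ) with hz
  have hz0 : 0 < z := by positivity
  have hz1 : z ≤ 1 := (div_le_one hnρ).mpr hkn
  have htr : ∀ B : Matrix (Fin n) (Fin n) ℝ, (B ^ (2 * k)).trace =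
      ∑ w : Fin (2 * k + 1) → Fin n, if w (Fin.last _) = w 0 then
        ∏ s : Fin (2 * k), B (w s.castSucc) (w s.succ) else 0 := by
    intro B
    simp only [Matrix.trace, Matrix.diag_apply, Matrix.pow_apply_eq_sum_walks]
    rw [Finset.sum_comm]
    refine Finset.sum_congr rfl fun w _ => ?_
    rw [Finset.sum_eq_single (w 0)]
    · simp
    · intro i _ hi
      rw [if_neg fun h => hi h.1.symm]
    · simp
  simp only [htr, Finset.mul_sum]
  rw [Finset.sum_comm]
  -- The walks that are not closed are added for free, their bounds being nonnegative.
  calc _ ≤ ∑ w : Fin (2 * k + 1) → Fin n, (z ^ k)⁻¹ * (ρ * z) ^ (walkEdges w).card := by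
        refine Finset.sum_le_sum fun w _ => ?_
        split_ifs
        · exact (le_abs_self _).trans (abs_walk_moment_le hp hρ0.le hρ hz0 hz1 w)
        · simp only [mul_zero, Finset.sum_const_zero]
          positivity
    _ = (z ^ k)⁻¹ * ∑ w : Fin (2 * k + 1) → Fin n, (ρ * z) ^ (walkEdges w).card := by
        rw [Finset.mul_sum]
    _ ≤ (z ^ k)⁻¹ * (n * ∏ l ∈ Finset.range (2 * k), (n * (ρ * z) + (l + 1))) := by
        gcongr
        exact sum_pow_card_walkEdges_le (by positivity) (mul_le_one₀ hρ1 hz0.le hz1) _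
    _ ≤ (z ^ k)⁻¹ * (n * ∏ l ∈ Finset.range (2 * k), (4 * k : ℝ)) := by
        gcongr with l hl
        have h1 : n * (ρ * z) = 2 * k := by
          rw [hz]; field_simp
        have h2 : (l : ℝ) + 1 ≤ 2 * k := by
          exact_mod_cast Finset.mem_range.mp hl
        linarith
    _ = n * (8 * k * (n * ρ)) ^ k := by
        rw [Finset.prod_const, Finset.card_range, pow_mul, mul_left_comm, ← inv_pow, ← mul_pow]
        congr 2
        rw [hz]
        field_simp
        ring

end Walks

/-! ### Operator norms from traces of powers. -/

section TraceNorm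

open scoped Matrix.Norms.L2Operator

variable {n : ℕ}

lemma l2_opNorm_sq_le_trace (M : Matrix (Fin n) (Fin n) ℝ) : ‖M‖ ^ 2 ≤ (Mᵀ * M).trace := by
  have hT : (Mᵀ * M).trace = ∑ i, ∑ j, M i j ^ 2 := by
    simp only [Matrix.trace, Matrix.diag_apply, Matrix.mul_apply, Matrix.transpose_apply, ← sq]
    exact Finset.sum_comm
  have h0 : 0 ≤ (Mᵀ * M).trace := by rw [hT]; positivity
  rw [← Real.sqrt_le_sqrt_iff h0, Real.sqrt_sq (norm_nonneg _)]
  refine Matrix.l2_opNorm_le_of_mulVec (Real.sqrt_nonneg _) fun v => ?_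
  refine abs_le_of_sq_le_sq' ?_ (by positivity) |>.2
  rw [mul_pow, Real.sq_sqrt h0, hT, EuclideanSpace.real_norm_sq_eq, EuclideanSpace.real_norm_sq_eq,
    Finset.sum_mul]
  exact Finset.sum_le_sum fun i _ => Finset.sum_mul_sq_le_sq_mul_sq Finset.univ (M i) v.ofLp

/-- The Frobenius norm of H^(2^j) dominates its operator norm. Exponents are powers of two because
the C*-identity gives ‖H^(2^j)‖ = ‖H‖^(2^j) by repeated squaring. -/
lemma l2_opNorm_pow_le_trace {H : Matrix (Fin n) (Fin n) ℝ} (hH : H.IsHermitian) (j : ℕ) :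
    ‖H‖ ^ (2 * 2 ^ j) ≤ (H ^ (2 * 2 ^ j)).trace := by
  have h1 : ‖H ^ 2 ^ j‖ = ‖H‖ ^ 2 ^ j := IsSelfAdjoint.norm_pow_two_pow hH j
  have h2 := l2_opNorm_sq_le_trace (H ^ 2 ^ j)
  have hHt : Hᵀ = H := by simpa using hH.eq
  rw [h1, Matrix.transpose_pow, hHt, ← pow_mul, ← pow_add] at h2
  rw [← mul_two] at h2
  rwa [mul_comm]

end TraceNorm

/-! ### Union, Markov and Chernoff bounds for finite Bernoulli products. -/

section BernoulliTail

variable {ι : Type*} [Fintype ι]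

/-- The probability of a set of values of independent Bernoulli variables with parameters `p`. -/
noncomputable def bernoulliProb (p : ι → ℝ) [DecidableEq ι] (S : Set (ι → Bool)) : ℝ :=
  ∑ g, bernoulliWeight p g * S.indicator 1 g

variable [DecidableEq ι] {p : ι → ℝ}

lemma bernoulliProb_iUnion_le {κ : Type*} [Fintype κ] (hp : ∀ e, p e ∈ Set.Icc (0 : ℝ) 1)
    {S : κ → Set (ι → Bool)} {ε : ℝ} (h : ∀ a, bernoulliProb p (S a) ≤ ε) :
    bernoulliProb p (⋃ a, S a) ≤ Fintype.card κ * ε := by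
  calc bernoulliProb p (⋃ a, S a) ≤ ∑ a, bernoulliProb p (S a) := by
        simp only [bernoulliProb]
        rw [Finset.sum_comm]
        refine Finset.sum_le_sum fun g _ => ?_
        rw [← Finset.mul_sum]
        refine mul_le_mul_of_nonneg_left ?_ (bernoulliWeight_nonneg hp g)
        have h0 : ∀ a, 0 ≤ (S a).indicator (1 : (ι → Bool) → ℝ) g := fun a =>
          Set.indicator_nonneg (fun _ _ => zero_le_one) g
        by_cases hg : g ∈ ⋃ a, S a
        · obtain ⟨a, ha⟩ := Set.mem_iUnion.mp hg
          rw [Set.indicator_of_mem hg]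
          refine le_trans ?_ (Finset.single_le_sum (fun a _ => h0 a) (Finset.mem_univ a))
          rw [Set.indicator_of_mem ha]
        · rw [Set.indicator_of_notMem hg]
          exact Finset.sum_nonneg fun a _ => h0 a
    _ ≤ ∑ _a : κ, ε := Finset.sum_le_sum fun a _ => h a
    _ = _ := by rw [Finset.sum_const, Finset.card_univ, nsmul_eq_mul]

lemma bernoulliProb_le_div (hp : ∀ e, p e ∈ Set.Icc (0 : ℝ) 1) {f : (ι → Bool) → ℝ}
    (hf : ∀ g, 0 ≤ f g) {s M : ℝ} (hs : 0 < s) (hM : ∑ g, bernoulliWeight p g * f g ≤ M) :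
    bernoulliProb p {g | s ≤ f g} ≤ M / s := by
  rw [le_div_iff₀ hs]
  refine le_trans ?_ hM
  rw [bernoulliProb, Finset.sum_mul]
  refine Finset.sum_le_sum fun g _ => ?_
  rw [mul_assoc]
  refine mul_le_mul_of_nonneg_left ?_ (bernoulliWeight_nonneg hp g)
  by_cases hg : s ≤ f g
  · rw [Set.indicator_of_mem (show g ∈ {g | s ≤ f g} from hg)]
    simpa using hg
  · rw [Set.indicator_of_notMem (show g ∉ {g | s ≤ f g} from hg), zero_mul]
    exact hf g

/-- From e^x ≤ 1 + x + x² for |x| ≤ 1: the linear terms cancel by centering and the quadratic ones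
give y² times the variance. -/
lemma bernoulli_mgf_le {q y : ℝ} (hq : q ∈ Set.Icc (0 : ℝ) 1) (hy : |y| ≤ 1) :
    q * Real.exp (y * (1 - q)) + (1 - q) * Real.exp (y * (0 - q)) ≤ Real.exp (y ^ 2 * q) := by
  obtain ⟨h0, h1⟩ := hq
  have hb : ∀ x : ℝ, |x| ≤ 1 → Real.exp x ≤ 1 + x + x ^ 2 := fun x hx => by
    have := (abs_le.mp (Real.abs_exp_sub_one_sub_id_le hx)).2
    linarith
  have e1 := hb (y * (1 - q)) (by
    rw [abs_mul, abs_of_nonneg (sub_nonneg.mpr h1)]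
    exact mul_le_one₀ hy (by linarith) (by linarith))
  have e2 := hb (y * (0 - q)) (by
    rw [abs_mul, zero_sub, abs_neg, abs_of_nonneg h0]
    exact mul_le_one₀ hy (by linarith) (by linarith))
  have h1' : 0 ≤ 1 - q := by linarith
  calc _ ≤ q * (1 + y * (1 - q) + (y * (1 - q)) ^ 2)
        + (1 - q) * (1 + y * (0 - q) + (y * (0 - q)) ^ 2) := by gcongr
    _ = 1 + y ^ 2 * q - y ^ 2 * q ^ 2 := by ring
    _ ≤ y ^ 2 * q + 1 := by nlinarith [mul_nonneg (sq_nonneg y) (sq_nonneg q)]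
    _ ≤ _ := Real.add_one_le_exp _

/-- Chernoff bound for linear forms in centered Bernoulli variables. -/
lemma bernoulliProb_linear_le (hp : ∀ e, p e ∈ Set.Icc (0 : ℝ) 1) {ρ : ℝ} (hρ : ∀ e, p e ≤ ρ)
    {c : ι → ℝ} (hc : ∀ e, |c e| ≤ 1) {Q : ℝ} (hρ0 : 0 ≤ ρ) (hQ : ∑ e, c e ^ 2 ≤ Q) {t : ℝ}
    (ht0 : 0 ≤ t) (ht1 : t ≤ 1) (s : ℝ) :
    bernoulliProb p {g | s ≤ ∑ e, centeredBit p g e * c e} ≤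
      Real.exp (t ^ 2 * (ρ * Q) - t * s) := by
  have hsub : bernoulliProb p {g | s ≤ ∑ e, centeredBit p g e * c e} ≤
      bernoulliProb p {g | Real.exp (t * s) ≤
        ∏ e, Real.exp (t * c e * ((if g e then 1 else 0) - p e))} := by
    refine Finset.sum_le_sum fun g _ => mul_le_mul_of_nonneg_left ?_ (bernoulliWeight_nonneg hp g)
    refine Set.indicator_le_indicator_of_subset (fun g hg => ?_) (fun _ => zero_le_one) g
    change Real.exp (t * s) ≤ ∏ e, Real.exp (t * c e * ((if g e then 1 else 0) - p e))
    rw [← Real.exp_sum, Real.exp_le_exp]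
    refine (mul_le_mul_of_nonneg_left hg ht0).trans (le_of_eq ?_)
    rw [Finset.mul_sum]
    exact Finset.sum_congr rfl fun e _ => by rw [centeredBit]; ring
  refine hsub.trans ((bernoulliProb_le_div hp
    (f := fun g => ∏ e, Real.exp (t * c e * ((if g e then 1 else 0) - p e)))
    (fun g => Finset.prod_nonneg fun _ _ => (Real.exp_pos _).le)
    (Real.exp_pos _) (M := Real.exp (t ^ 2 * (ρ * Q))) ?_).trans ?_)
  · rw [sum_bernoulliWeight_mul_prod p fun e b => Real.exp (t * c e * ((if b then 1 else 0) - p e))]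
    simp only [if_true, Bool.false_eq_true, if_false]
    calc _ ≤ ∏ e, Real.exp ((t * c e) ^ 2 * p e) := by
          refine Finset.prod_le_prod (fun e _ => ?_) fun e _ => bernoulli_mgf_le (hp e) ?_
          · have := (hp e).1
            have := sub_nonneg.mpr (hp e).2
            positivity
          · rw [abs_mul, abs_of_nonneg ht0]
            exact mul_le_one₀ ht1 (abs_nonneg _) (hc e)
      _ = Real.exp (∑ e, (t * c e) ^ 2 * p e) := (Real.exp_sum _ _).symm
      _ ≤ _ := by
          rw [Real.exp_le_exp]
          calc _ ≤ ∑ e, t ^ 2 * (ρ * c e ^ 2) := by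
                refine Finset.sum_le_sum fun e _ => ?_
                rw [mul_pow, mul_assoc, mul_comm (c e ^ 2)]
                gcongr
                exact hρ e
            _ = t ^ 2 * (ρ * ∑ e, c e ^ 2) := by rw [Finset.mul_sum, Finset.mul_sum]
            _ ≤ _ := by gcongr
  · rw [← Real.exp_sub]

end BernoulliTail

/-! ### Row sums as linear forms in independent edges. -/

section Incidence

variable {n : ℕ}

/-- The coefficients of the linear form `c ↦ ∑ j, hollowMatrix c i j * a j`. -/
def incidenceCoeff (i : Fin n) (a : Fin n → ℝ) (e : EdgeIdx n) : ℝ :=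
  if e.1.1 = i then a e.1.2 else if e.1.2 = i then a e.1.1 else 0

/-- Each j ≠ i corresponds to the one edge joining it to i; this is what makes the Chernoff bound
for independent edges applicable to a row of a symmetric matrix. -/
lemma sum_hollowMatrix_mul (c : EdgeIdx n → ℝ) (i : Fin n) (a : Fin n → ℝ) :
    ∑ j, hollowMatrix c i j * a j = ∑ e, c e * incidenceCoeff i a e := by
  have h1 : ∑ j, hollowMatrix c i j * a j =
      ∑ j ∈ Finset.univ.filter (fun j => i ≠ j), hollowMatrix c i j * a j := by
    rw [Finset.sum_filter_of_ne]
    rintro j - hj rfl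
    exact hj (by rw [hollowMatrix_apply_self, zero_mul])
  have h2 : ∑ e, c e * incidenceCoeff i a e =
      ∑ e ∈ Finset.univ.filter (fun e : EdgeIdx n => e.1.1 = i ∨ e.1.2 = i),
        c e * incidenceCoeff i a e := by
    rw [Finset.sum_filter_of_ne]
    intro e _ he
    by_contra hcon
    push Not at hcon
    exact he (by rw [incidenceCoeff, if_neg hcon.1, if_neg hcon.2, mul_zero])
  rw [h1, h2]
  refine Finset.sum_bij (fun j hj => ⟨(min i j, max i j),
    min_lt_max.mpr (Finset.mem_filter.mp hj).2⟩) ?_ ?_ ?_ ?_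
  · intro j hj
    rw [Finset.mem_filter]
    refine ⟨Finset.mem_univ _, ?_⟩
    rcases le_total i j with h | h
    · left; exact min_eq_left h
    · right; exact max_eq_left h
  · intro j hj l hl h
    have h3 := congrArg Subtype.val h
    simp only [Prod.mk.injEq] at h3
    obtain ⟨h3, h4⟩ := h3
    rcases le_total i j with hij | hij <;> rcases le_total i l with hil | hil <;>
      simp_all
  · intro e he
    rcases (Finset.mem_filter.mp he).2 with h | h
    · refine ⟨e.1.2, ?_, ?_⟩
      · rw [Finset.mem_filter]
        exact ⟨Finset.mem_univ _, by rw [← h]; exact e.2.ne⟩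
      · subst h
        ext1
        exact Prod.ext (min_eq_left e.2.le) (max_eq_right e.2.le)
    · refine ⟨e.1.1, ?_, ?_⟩
      · rw [Finset.mem_filter]
        exact ⟨Finset.mem_univ _, by rw [← h]; exact e.2.ne'⟩
      · subst h
        ext1
        exact Prod.ext (min_eq_right e.2.le) (max_eq_left e.2.le)
  · intro j hj
    have hij := (Finset.mem_filter.mp hj).2
    rw [hollowMatrix_apply_of_ne c hij]
    congr 1
    rw [incidenceCoeff]
    rcases lt_or_gt_of_ne hij with h | h
    · rw [if_pos (min_eq_left h.le)]
      exact congrArg a (max_eq_right h.le).symm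
    · rw [if_neg, if_pos (max_eq_left h.le)]
      · exact congrArg a (min_eq_right h.le).symm
      · exact fun h' => h.ne ((min_eq_right h.le).symm.trans h')

lemma abs_incidenceCoeff_le {i : Fin n} {a : Fin n → ℝ} (ha : ∀ j, |a j| ≤ 1) (e : EdgeIdx n) :
    |incidenceCoeff i a e| ≤ 1 := by
  rw [incidenceCoeff]
  split_ifs
  · exact ha _
  · exact ha _
  · simp

lemma sum_incidenceCoeff_sq_le {i : Fin n} {a : Fin n → ℝ} (ha : ∀ j, |a j| ≤ 1) :
    ∑ e, incidenceCoeff i a e ^ 2 ≤ n := by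
  -- Squared coefficients are the coefficients of the squared weights, so the same identity with c =
  -- 1 counts them.
  have h1 : ∑ e, incidenceCoeff i a e ^ 2 = ∑ e, 1 * incidenceCoeff i (fun j => a j ^ 2) e := by
    refine Finset.sum_congr rfl fun e _ => ?_
    simp only [incidenceCoeff, one_mul]
    split_ifs <;> simp
  rw [h1, ← sum_hollowMatrix_mul (fun _ => 1)]
  calc _ ≤ ∑ _j : Fin n, (1 : ℝ) := by
        refine Finset.sum_le_sum fun j _ => ?_
        have h2 : a j ^ 2 ≤ 1 := (sq_le_one_iff_abs_le_one _).mpr (ha j)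
        by_cases h : i = j
        · rw [h, hollowMatrix_apply_self, zero_mul]; exact zero_le_one
        · rw [hollowMatrix_apply_of_ne _ h, one_mul]; exact h2
    _ = n := by simp

/-- Chernoff bound for the linear combinations of a row of the centered adjacency matrix. -/
lemma bernoulliProb_row_le {p : EdgeIdx n → ℝ} (hp : ∀ e, p e ∈ Set.Icc (0 : ℝ) 1) {ρ : ℝ}
    (hρ0 : 0 ≤ ρ) (hρ : ∀ e, p e ≤ ρ) (i : Fin n) {a : Fin n → ℝ} (ha : ∀ j, |a j| ≤ 1) {t : ℝ}
    (ht0 : 0 ≤ t) (ht1 : t ≤ 1) (s : ℝ) :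
    bernoulliProb p {g | s ≤ ∑ j, hollowMatrix (centeredBit p g) i j * a j} ≤
      Real.exp (t ^ 2 * (ρ * n) - t * s) := by
  simp only [sum_hollowMatrix_mul]
  exact bernoulliProb_linear_le hp hρ (abs_incidenceCoeff_le ha) hρ0 (sum_incidenceCoeff_sq_le ha)
    ht0 ht1 s

end Incidence

/-! ### From conditional to unconditional probabilities. -/

section Transfer

variable {n d : ℕ}

/-- The edge probabilities of a random dot product graph with latent positions `x`. -/
noncomputable def edgeProb (r : ℝ) (x : Fin n → EuclideanSpace ℝ (Fin d)) (e : EdgeIdx n) : ℝ :=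
  r * inner ℝ (x e.1.1) (x e.1.2)

/-- The adjacency matrix of the graph with edge set `g`. -/
def bitAdjacency (g : EdgeIdx n → Bool) : Matrix (Fin n) (Fin n) ℝ :=
  hollowMatrix fun e => if g e then 1 else 0

/-- The edge set of the graph with adjacency matrix `a`. -/
noncomputable def edgeBits (a : Matrix (Fin n) (Fin n) ℝ) (e : EdgeIdx n) : Bool :=
  decide (a e.1.1 e.1.2 = 1)

lemma isAdjacency_bitAdjacency (g : EdgeIdx n → Bool) : IsAdjacency (bitAdjacency g) where
  symm := hollowMatrix_symm _
  hollow := hollowMatrix_apply_self _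
  zero_or_one i j := by
    by_cases h : i = j
    · left; rw [h]; exact hollowMatrix_apply_self _ j
    · rw [bitAdjacency, hollowMatrix_apply_of_ne _ h]
      split_ifs <;> simp

lemma IsAdjacency.bitAdjacency_edgeBits {a : Matrix (Fin n) (Fin n) ℝ} (ha : IsAdjacency a) :
    bitAdjacency (edgeBits a) = a := by
  have key : ∀ i j : Fin n, i < j → bitAdjacency (edgeBits a) i j = a i j := by
    intro i j h
    rw [bitAdjacency, hollowMatrix_apply_of_lt _ h, edgeBits]
    rcases ha.zero_or_one i j with h0 | h0 <;> simp [h0]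
  ext i j
  rcases lt_trichotomy i j with h | h | h
  · exact key i j h
  · rw [h, ha.hollow]; exact hollowMatrix_apply_self _ j
  · rw [ha.symm, ← key j i h]; exact hollowMatrix_symm _ i j

lemma edgeLikelihood_bitAdjacency (r : ℝ) (x : Fin n → EuclideanSpace ℝ (Fin d))
    (g : EdgeIdx n → Bool) :
    edgeLikelihood r x (bitAdjacency g) = bernoulliWeight (edgeProb r x) g := by
  rw [edgeLikelihood, bernoulliWeight, Finset.prod_subtype (p := fun p : Fin n × Fin n => p.1 < p.2)
    (Finset.univ.filter fun p : Fin n × Fin n => p.1 < p.2) (by simp)]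
  refine Finset.prod_congr rfl fun e _ => ?_
  rw [bitAdjacency, hollowMatrix_apply_of_lt _ e.2]
  cases g e <;> simp [edgeProb]

lemma centeredBit_bitAdjacency_of_ne (r : ℝ) (x : Fin n → EuclideanSpace ℝ (Fin d))
    (g : EdgeIdx n → Bool) {i j : Fin n} (h : i ≠ j) :
    hollowMatrix (centeredBit (edgeProb r x) g) i j =
      bitAdjacency g i j - r * inner ℝ (x i) (x j) := by
  rw [bitAdjacency, hollowMatrix_apply_of_ne _ h, hollowMatrix_apply_of_ne _ h, centeredBit,
    edgeProb]
  rcases lt_or_gt_of_ne h with h | h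
  · simp only [min_eq_left h.le, max_eq_right h.le]
  · simp only [min_eq_right h.le, max_eq_left h.le, real_inner_comm]

/-- A bound on conditional probabilities given the latent positions is a bound on probabilities. -/
lemma IsRDPG.measureReal_le {Ω : Type*} [MeasurableSpace Ω] {μ : Measure Ω}
    [IsProbabilityMeasure μ] {F : Measure (EuclideanSpace ℝ (Fin d))} {r : ℝ}
    {X : Ω → Fin n → EuclideanSpace ℝ (Fin d)} {A : Ω → Matrix (Fin n) (Fin n) ℝ}
    (h : IsRDPG μ F r X A) {S : (Fin n → EuclideanSpace ℝ (Fin d)) → Set (EdgeIdx n → Bool)}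
    (hS : ∀ g, MeasurableSet {x | g ∈ S x}) {ε : ℝ}
    (hε : ∀ᵐ ω ∂μ, bernoulliProb (edgeProb r (X ω)) (S (X ω)) ≤ ε) :
    μ.real {ω | edgeBits (A ω) ∈ S (X ω)} ≤ ε := by
  have hX : Measurable X := measurable_pi_lambda _ h.measurable_pos
  have hAmeas : ∀ g, MeasurableSet {ω | A ω = bitAdjacency g} := by
    intro g
    have : {ω | A ω = bitAdjacency g} = ⋂ i, ⋂ j, {ω | A ω i j = bitAdjacency g i j} := by
      ext ω
      simp only [Set.mem_iInter, Set.mem_ofPred_eq]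
      exact ⟨fun h i j => by rw [h], fun h => by ext i j; exact h i j⟩
    rw [this]
    exact MeasurableSet.iInter fun i => MeasurableSet.iInter fun j =>
      measurableSet_eq_fun (h.measurable_adj i j) measurable_const
  have hm : MeasurableSpace.comap X inferInstance ≤ ‹MeasurableSpace Ω› := hX.comap_le
  -- A takes finitely many values; on each piece the remaining condition depends on X alone, so the
  -- conditional probability can be integrated over it.
  have hcover : {ω | edgeBits (A ω) ∈ S (X ω)} ⊆
      ⋃ g, ({ω | A ω = bitAdjacency g} ∩ X ⁻¹' {x | g ∈ S x}) := by
    intro ω hω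
    refine Set.mem_iUnion.mpr ⟨edgeBits (A ω), ?_, hω⟩
    exact ((h.isAdjacency ω).bitAdjacency_edgeBits).symm
  -- The likelihood is integrable because it is almost everywhere a conditional expectation.
  have hint : ∀ g, Integrable (fun ω => bernoulliWeight (edgeProb r (X ω)) g) μ := by
    intro g
    refine (integrable_condExp (m := MeasurableSpace.comap X inferInstance)
      (f := {ω | A ω = bitAdjacency g}.indicator fun _ => (1 : ℝ))).congr ?_
    refine (h.condProb _ (isAdjacency_bitAdjacency g)).trans ?_
    exact Filter.Eventually.of_forall fun ω => edgeLikelihood_bitAdjacency r (X ω) g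
  have hpiece : ∀ g, μ.real ({ω | A ω = bitAdjacency g} ∩ X ⁻¹' {x | g ∈ S x}) =
      ∫ ω, bernoulliWeight (edgeProb r (X ω)) g * (S (X ω)).indicator 1 g ∂μ := by
    intro g
    have hT : MeasurableSet[MeasurableSpace.comap X inferInstance] (X ⁻¹' {x | g ∈ S x}) :=
      ⟨_, hS g, rfl⟩
    have h1 := setIntegral_condExp hm (μ := μ)
      (f := {ω | A ω = bitAdjacency g}.indicator fun _ => (1 : ℝ))
      ((integrable_const (1 : ℝ)).indicator (hAmeas g)) hT
    rw [setIntegral_congr_ae (g := fun ω => bernoulliWeight (edgeProb r (X ω)) g) (hm _ hT)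
      ((h.condProb _ (isAdjacency_bitAdjacency g)).mono fun ω hω _ =>
        hω.trans (edgeLikelihood_bitAdjacency r (X ω) g)),
      integral_indicator (hAmeas g), setIntegral_const, smul_eq_mul, mul_one,
      measureReal_restrict_apply (hAmeas g)] at h1
    rw [← h1, ← integral_indicator (hm _ hT)]
    refine integral_congr_ae (Filter.Eventually.of_forall fun ω => ?_)
    by_cases hω : g ∈ S (X ω)
    · simp [Set.indicator, hω]
    · simp [Set.indicator, hω]
  have hint' : ∀ g, Integrable
      (fun ω => bernoulliWeight (edgeProb r (X ω)) g * (S (X ω)).indicator 1 g) μ := by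
    intro g
    have hT : MeasurableSet (X ⁻¹' {x | g ∈ S x}) := hX (hS g)
    refine ((hint g).indicator hT).congr (Filter.Eventually.of_forall fun ω => ?_)
    by_cases hω : g ∈ S (X ω)
    · simp [Set.indicator, hω]
    · simp [Set.indicator, hω]
  calc μ.real {ω | edgeBits (A ω) ∈ S (X ω)}
      ≤ μ.real (⋃ g, ({ω | A ω = bitAdjacency g} ∩ X ⁻¹' {x | g ∈ S x})) :=
        measureReal_mono hcover
    _ ≤ ∑ g, μ.real ({ω | A ω = bitAdjacency g} ∩ X ⁻¹' {x | g ∈ S x}) :=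
        measureReal_iUnion_fintype_le _
    _ = ∫ ω, bernoulliProb (edgeProb r (X ω)) (S (X ω)) ∂μ := by
        simp only [hpiece, bernoulliProb]
        rw [integral_finsetSum _ fun g _ => hint' g]
    _ ≤ ∫ _, ε ∂μ := by
        refine integral_mono_ae ?_ (integrable_const _) hε
        simp only [bernoulliProb]
        exact integrable_finsetSum _ fun g _ => hint' g
    _ = ε := by simp

end Transfer

/-! ### Concentration of the empirical second moments. -/

section Gram

variable {n d : ℕ} {Ω : Type*} [MeasurableSpace Ω] {μ : Measure Ω} [IsProbabilityMeasure μ]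
  {F : Measure (EuclideanSpace ℝ (Fin d))} {r : ℝ}
  {X : Ω → Fin n → EuclideanSpace ℝ (Fin d)} {A : Ω → Matrix (Fin n) (Fin n) ℝ}

lemma IsRDPG.measureReal_sum_ge_le (h : IsRDPG μ F r X A) {f : EuclideanSpace ℝ (Fin d) → ℝ}
    (hf : Measurable f) (hf1 : ∀ᵐ x ∂F, f x ∈ Set.Icc (-1 : ℝ) 1) {ε : ℝ} (hε : 0 ≤ ε) :
    μ.real {ω | ε ≤ ∑ i, (f (X ω i) - ∫ x, f x ∂F)} ≤ Real.exp (-ε ^ 2 / (2 * n)) := by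
  have hmean : ∀ i, ∫ ω, f (X ω i) ∂μ = ∫ x, f x ∂F := fun i => by
    rw [← h.law_pos i, integral_map (h.measurable_pos i).aemeasurable
      hf.aestronglyMeasurable]
  have hae : ∀ i, ∀ᵐ ω ∂μ, f (X ω i) ∈ Set.Icc (-1 : ℝ) 1 := fun i =>
    ae_of_ae_map (h.measurable_pos i).aemeasurable (by rw [h.law_pos i]; exact hf1)
  have hind : iIndepFun (fun i ω => f (X ω i) - ∫ x, f x ∂F) μ :=
    h.indep_pos.comp (fun _ x => f x - ∫ x, f x ∂F) fun _ => hf.sub_const _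
  have hsub : ∀ i ∈ (Finset.univ : Finset (Fin n)),
      HasSubgaussianMGF (fun ω => f (X ω i) - ∫ x, f x ∂F) 1 μ := by
    intro i _
    have := hasSubgaussianMGF_of_mem_Icc
      (hf.comp (h.measurable_pos i)).aemeasurable (hae i)
    simp only [Function.comp_apply, hmean] at this
    -- Hoeffding's lemma on [-1, 1]: the variance proxy is ((1 - (-1)) / 2)² = 1.
    convert this using 1
    norm_num
  refine (HasSubgaussianMGF.measure_sum_ge_le_of_iIndepFun hind hsub hε).trans (le_of_eq ?_)
  simp

/-- Hoeffding for both signs of each of the d² bounded products, then a union bound; the dependence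
of the bound on d is harmless since d is fixed as n grows. -/
lemma IsRDPG.measureReal_gram_le (h : IsRDPG μ F r X A) (hF : ∀ᵐ x ∂F, ‖x‖ ≤ 1) {ε : ℝ}
    (hε : 0 ≤ ε) :
    μ.real {ω | ∃ j k, n * ε ≤ |∑ i, X ω i j * X ω i k - n * secondMoment F j k|} ≤
      d * (d * (2 * Real.exp (-(n * ε ^ 2) / 2))) := by
  have hone : ∀ j k, μ.real {ω | n * ε ≤ |∑ i, X ω i j * X ω i k - n * secondMoment F j k|} ≤
      2 * Real.exp (-(n * ε ^ 2) / 2) := by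
    intro j k
    have hmeas : Measurable fun x : EuclideanSpace ℝ (Fin d) => x j * x k := by fun_prop
    have hbd : ∀ᵐ x ∂F, x j * x k ∈ Set.Icc (-1 : ℝ) 1 := by
      filter_upwards [hF] with x hx
      have h1 : |x j| ≤ 1 := (PiLp.norm_apply_le x j).trans hx
      have h2 : |x k| ≤ 1 := (PiLp.norm_apply_le x k).trans hx
      rw [Set.mem_Icc, ← abs_le, abs_mul]
      exact mul_le_one₀ h1 (abs_nonneg _) h2
    have hexp : -(n * ε) ^ 2 / (2 * n) = -(n * ε ^ 2) / 2 := by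
      rcases Nat.eq_zero_or_pos n with hn | hn
      · simp [hn]
      · have : (n : ℝ) ≠ 0 := by positivity
        field_simp
    have b1 := h.measureReal_sum_ge_le hmeas hbd (ε := n * ε) (by positivity)
    have b2 := h.measureReal_sum_ge_le hmeas.neg (f := fun x => -(x j * x k))
      (hbd.mono fun x hx => ⟨by linarith [hx.2], by linarith [hx.1]⟩) (ε := n * ε) (by positivity)
    rw [hexp] at b1 b2
    rw [two_mul]
    refine le_trans ?_ (add_le_add b1 b2)
    refine le_trans (measureReal_mono ?_) (measureReal_union_le _ _)
    intro ω hω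
    have hω' : n * ε ≤ |∑ i, X ω i j * X ω i k - n * secondMoment F j k| := hω
    rcases le_abs.mp hω' with h1 | h1
    · left
      change n * ε ≤ _
      rw [Finset.sum_sub_distrib]
      simpa [secondMoment] using h1
    · right
      change n * ε ≤ _
      rw [Finset.sum_sub_distrib]
      simp only [integral_neg, Finset.sum_neg_distrib, Finset.sum_const, Finset.card_univ,
        Fintype.card_fin, nsmul_eq_mul]
      simp only [secondMoment, Matrix.of_apply] at h1
      linarith
  have hU : ∀ {κ : Type} [Fintype κ] (S : κ → Set Ω) (c : ℝ), (∀ a, μ.real (S a) ≤ c) →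
      μ.real (⋃ a, S a) ≤ Fintype.card κ * c := by
    intro κ _ S c hc
    refine (measureReal_iUnion_fintype_le _).trans ((Finset.sum_le_sum fun a _ => hc a).trans ?_)
    rw [Finset.sum_const, Finset.card_univ, nsmul_eq_mul]
  have := hU (fun j => ⋃ k, {ω | n * ε ≤ |∑ i, X ω i j * X ω i k - n * secondMoment F j k|}) _
    fun j => hU _ _ fun k => hone j k
  simp only [Fintype.card_fin] at this
  refine le_trans (le_of_eq ?_) this
  congr 1
  ext ω
  simp

end Gram

/-! ### Lower bounds for quadratic forms of second moment and Gram matrices. -/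

section SecondMoment

open scoped Matrix.Norms.L2Operator

variable {n d : ℕ}

lemma Matrix.PosSemidef.exists_pos_le_quadForm {M : Matrix (Fin d) (Fin d) ℝ}
    (hM : M.PosSemidef) (hrank : M.rank = d) :
    ∃ δ : ℝ, 0 < δ ∧ ∀ u : Fin d → ℝ, δ * (u ⬝ᵥ u) ≤ u ⬝ᵥ (M *ᵥ u) := by
  set Q := CFC.sqrt M with hQ
  have hQQ : Q * Q = M := CFC.sqrt_mul_sqrt_self _ hM.nonneg
  have hQ0 : Q.PosSemidef := Matrix.nonneg_iff_posSemidef.mp (CFC.sqrt_nonneg _)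
  have hQt : Qᵀ = Q := by simpa using hQ0.isHermitian.eq
  have hrQ : Q.rank = d := by
    refine le_antisymm (by simpa using Q.rank_le_width) ?_
    calc d = (Q * Q).rank := by rw [hQQ, hrank]
      _ ≤ Q.rank := Matrix.rank_mul_le_left _ _
  have hinj : ∀ u : Fin d → ℝ, Q *ᵥ u = 0 → u = 0 := by
    intro u hu
    have h1 : Function.Surjective Q.mulVecLin := by
      rw [← LinearMap.range_eq_top]
      apply Submodule.eq_top_of_finrank_eq
      rw [Module.finrank_fin_fun]
      exact hrQ
    have h2 := LinearMap.injective_iff_surjective.mpr h1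
    exact h2 (by simpa using hu)
  have hdet : IsUnit Q.det := by
    rw [isUnit_iff_ne_zero]
    intro h0
    obtain ⟨u, hu, hu'⟩ := Matrix.exists_mulVec_eq_zero_iff.mpr h0
    exact hu (hinj u hu')
  -- From ‖u‖ ≤ ‖Q⁻¹‖‖Qu‖; adding 1 keeps the constant positive even if ‖Q⁻¹‖ = 0, as when d = 0.
  refine ⟨((‖Q⁻¹‖ + 1) ^ 2)⁻¹, by positivity, fun u => ?_⟩
  rw [inv_mul_le_iff₀ (by positivity), ← hQQ, show Q * Q = Qᵀ * Q by rw [hQt],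
    ← Matrix.norm_sq_toLp_mulVec, ← norm_sq_toLp_eq_dotProduct, ← mul_pow]
  gcongr
  have h1 := Matrix.l2_opNorm_mulVec Q⁻¹ (WithLp.toLp 2 (Q *ᵥ u))
  simp only [Matrix.mulVec_mulVec, Matrix.nonsing_inv_mul _ hdet, Matrix.one_mulVec] at h1
  exact h1.trans (by gcongr; linarith)

lemma posSemidef_secondMoment {F : Measure (EuclideanSpace ℝ (Fin d))} [IsProbabilityMeasure F]
    (hF : ∀ᵐ x ∂F, ‖x‖ ≤ 1) : (secondMoment F).PosSemidef := by
  have hint : ∀ j k, Integrable (fun x : EuclideanSpace ℝ (Fin d) => x j * x k) F := by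
    intro j k
    refine Integrable.of_bound (C := 1) (by fun_prop) ?_
    filter_upwards [hF] with x hx
    rw [norm_mul]
    exact mul_le_one₀ ((PiLp.norm_apply_le x j).trans hx) (norm_nonneg _)
      ((PiLp.norm_apply_le x k).trans hx)
  refine Matrix.PosSemidef.of_dotProduct_mulVec_nonneg ?_ fun u => ?_
  · ext j k
    simp only [secondMoment, Matrix.conjTranspose_apply, Matrix.of_apply, star_trivial, mul_comm]
  · have : star u ⬝ᵥ (secondMoment F *ᵥ u) = ∫ x, (∑ j, u j * x j) ^ 2 ∂F := by
      simp only [secondMoment, star_trivial, dotProduct, Matrix.mulVec, Matrix.of_apply]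
      simp only [← integral_mul_const]
      have h2 : ∀ x : EuclideanSpace ℝ (Fin d), (∑ j, u j * x j) ^ 2 =
          ∑ j, u j * ∑ k, x j * x k * u k := by
        intro x
        rw [sq, Finset.sum_mul]
        refine Finset.sum_congr rfl fun j _ => ?_
        rw [Finset.mul_sum, Finset.mul_sum]
        exact Finset.sum_congr rfl fun k _ => by ring
      simp only [h2]
      rw [integral_finsetSum _ fun j _ => Integrable.const_mul
        (integrable_finsetSum _ fun k _ => (hint j k).mul_const _) _]
      refine Finset.sum_congr rfl fun j _ => ?_
      rw [integral_const_mul, integral_finsetSum _ fun k _ => (hint j k).mul_const _]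
    rw [this]
    exact integral_nonneg fun x => sq_nonneg _

/-- If the empirical second moments are close to those of the law then the Gram matrix of the
latent positions is bounded below. -/
lemma gram_ge_of_entries {M : Matrix (Fin d) (Fin d) ℝ} {δ ε : ℝ} (hε : 0 ≤ ε)
    (hM : ∀ u : Fin d → ℝ, 2 * δ * (u ⬝ᵥ u) ≤ u ⬝ᵥ (M *ᵥ u)) (hεδ : d * ε ≤ δ)
    {x : Matrix (Fin n) (Fin d) ℝ}
    (hx : ∀ j k, |∑ i, x i j * x i k - n * M j k| ≤ n * ε) (u : Fin d → ℝ) :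
    δ * n * (u ⬝ᵥ u) ≤ u ⬝ᵥ ((xᵀ * x) *ᵥ u) := by
  have hE : |u ⬝ᵥ ((xᵀ * x - (n : ℝ) • M) *ᵥ u)| ≤ n * δ * (u ⬝ᵥ u) := by
    calc |u ⬝ᵥ ((xᵀ * x - (n : ℝ) • M) *ᵥ u)| ≤ ∑ j, ∑ k, |u j| * (n * ε * |u k|) := by
          simp only [dotProduct, Matrix.mulVec]
          refine (Finset.abs_sum_le_sum_abs _ _).trans (Finset.sum_le_sum fun j _ => ?_)
          rw [abs_mul, ← Finset.mul_sum]
          gcongr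
          refine (Finset.abs_sum_le_sum_abs _ _).trans (Finset.sum_le_sum fun k _ => ?_)
          rw [abs_mul]
          gcongr
          have := hx j k
          simpa [Matrix.mul_apply] using this
      _ = n * ε * (∑ j, |u j|) ^ 2 := by
          rw [sq, Finset.sum_mul_sum, Finset.mul_sum]
          refine Finset.sum_congr rfl fun j _ => ?_
          rw [Finset.mul_sum]
          exact Finset.sum_congr rfl fun k _ => by ring
      _ ≤ n * ε * (d * (u ⬝ᵥ u)) := by
          gcongr
          have := sq_sum_le_card_mul_sum_sq (s := Finset.univ) (f := fun j => |u j|)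
          simpa [dotProduct, sq_abs, sq] using this
      _ = n * (d * ε) * (u ⬝ᵥ u) := by ring
      _ ≤ _ := by
          have : 0 ≤ u ⬝ᵥ u := by rw [← norm_sq_toLp_eq_dotProduct]; positivity
          gcongr
  have h1 := (abs_le.mp hE).1
  rw [Matrix.sub_mulVec, dotProduct_sub, Matrix.smul_mulVec, dotProduct_smul, smul_eq_mul] at h1
  have h2 := mul_le_mul_of_nonneg_left (hM u) (Nat.cast_nonneg (α := ℝ) n)
  linarith

end SecondMoment

/-! ### Degree bound for embedding rows, and the size of the rowwise error. -/

section Deterministic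

open scoped Matrix.Norms.L2Operator

variable {n d : ℕ}

/-- The rows of a spectral embedding are bounded by the fourth roots of the degrees. -/
lemma IsASE.norm_pow_four_le {a : Matrix (Fin n) (Fin n) ℝ} (ha : IsAdjacency a)
    {Xhat : Fin n → EuclideanSpace ℝ (Fin d)} (h : IsASE a Xhat) (i : Fin n) :
    ‖Xhat i‖ ^ 4 ≤ ∑ j, a i j := by
  obtain ⟨hdn, V, s, hVo, hs, hVs, hXV⟩ := h
  have hV : V * Vᵀ = 1 := (Matrix.mem_orthogonalGroup_iff _ _).mp hVo
  have hV' : Vᵀ * V = 1 := mul_eq_one_comm.mp hV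
  have hBpsd : (matrixAbs a).PosSemidef := Matrix.nonneg_iff_posSemidef.mp (CFC.sqrt_nonneg _)
  have hs0 : ∀ j, 0 ≤ s j := nonneg_of_matrixAbs_eq hV' hVs
  -- The left side is the diagonal entry of |a| truncated to d eigenvalues; the omitted terms are
  -- nonnegative.
  have h1 : ‖Xhat i‖ ^ 2 ≤ matrixAbs a i i := by
    rw [EuclideanSpace.real_norm_sq_eq, hVs, Matrix.mul_apply]
    simp only [hXV, mul_pow, Real.sq_sqrt (hs0 _), Matrix.mul_diagonal, Matrix.transpose_apply]
    rw [sum_castLE_eq hdn fun j => V i j ^ 2 * s j]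
    refine Finset.sum_le_sum fun j _ => ?_
    have := hs0 j
    split_ifs
    · exact le_of_eq (by ring)
    · have h2 : V i j * s j * V i j = V i j ^ 2 * s j := by ring
      rw [h2]; positivity
  have h2 : matrixAbs a * matrixAbs a = aᵀ * a := by
    refine CFC.sqrt_mul_sqrt_self _ ?_
    rw [Matrix.nonneg_iff_posSemidef]
    simpa using Matrix.posSemidef_conjTranspose_mul_self a
  have h3 : (matrixAbs a i i) ^ 2 ≤ ∑ j, a i j := by
    have e1 : ∑ j, matrixAbs a i j ^ 2 = ∑ j, a i j := by
      have := congrFun (congrFun h2 i) i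
      rw [Matrix.mul_apply, Matrix.mul_apply] at this
      have hsymm : ∀ j, matrixAbs a j i = matrixAbs a i j := fun j => by
        simpa using congrFun (congrFun hBpsd.isHermitian.eq i) j
      simp only [hsymm, ← sq] at this
      rw [this]
      refine Finset.sum_congr rfl fun j _ => ?_
      rw [Matrix.transpose_apply, ha.symm j i]
      rcases ha.zero_or_one i j with h | h <;> rw [h] <;> norm_num
    rw [← e1]
    exact Finset.single_le_sum (f := fun j => matrixAbs a i j ^ 2) (fun _ _ => sq_nonneg _)
      (Finset.mem_univ i)
  calc ‖Xhat i‖ ^ 4 = (‖Xhat i‖ ^ 2) ^ 2 := by ring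
    _ ≤ (matrixAbs a i i) ^ 2 := by gcongr
    _ ≤ _ := h3

/-- The constant in the rowwise error bound. -/
noncomputable def rowErrorConst (K δ : ℝ) : ℝ :=
  (K + 4 * K ^ 2 / δ) * √(2 / δ) * (2 / δ) + 18 * K ^ 2 * √(2 / δ) / δ + 3 * K * √(2 / δ) / δ
    + 6 * K / δ ^ 2

/-- The left side is the bound of `ase_row_bound` at y = q, lam = δq² and σ = τ = Kql. Every term is
of order l / q or l² / q. -/
lemma row_error_le {K δ q l : ℝ} (hK : 0 ≤ K) (hδ : 0 < δ) (hq : 0 < q) (hl : 1 ≤ l) :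
    (K * q * l + 4 * (K * q * l) ^ 2 * (q / (δ * q ^ 2))) *
        (q * √(2 / (δ * q ^ 2)) * (2 / (δ * q ^ 2)))
      + 3 * (K * q * l) * (3 * (K * q * l) * √(2 / (δ * q ^ 2))) * (2 / (δ * q ^ 2))
      + q / (δ * q ^ 2) * (3 * (K * q * l) * √(2 / (δ * q ^ 2)))
      + q / (δ * q ^ 2) * (2 * (3 * (K * q * l))) * (q / (δ * q ^ 2))
      ≤ rowErrorConst K δ * l ^ 2 / q := by
  have hb : √(2 / (δ * q ^ 2)) = √(2 / δ) / q := by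
    rw [← div_div, Real.sqrt_div (by positivity), Real.sqrt_sq hq.le]
  rw [hb]
  set b := √(2 / δ) with hbdef
  have hb0 : 0 ≤ b := Real.sqrt_nonneg _
  have hll : l ≤ l ^ 2 := by nlinarith
  calc _ = (K * l + 4 * K ^ 2 * l ^ 2 / δ) * b * (2 / δ) / q + 18 * K ^ 2 * b / δ * l ^ 2 / q
        + 3 * K * b / δ * l / q + 6 * K / δ ^ 2 * l / q := by
        field_simp
        ring
    _ ≤ (K * l ^ 2 + 4 * K ^ 2 * l ^ 2 / δ) * b * (2 / δ) / q + 18 * K ^ 2 * b / δ * l ^ 2 / q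
        + 3 * K * b / δ * l ^ 2 / q + 6 * K / δ ^ 2 * l ^ 2 / q := by gcongr
    _ = _ := by
        rw [rowErrorConst]
        ring

end Deterministic

/-! ### The error bound on the good events of the dense and the sparse regime. -/

section Deterministic

open scoped Matrix.Norms.L2Operator

variable {n d : ℕ}

lemma norm_le_sqrt_mul_of_abs_le (v : EuclideanSpace ℝ (Fin d)) {M : ℝ} (hM : 0 ≤ M)
    (hv : ∀ k, |v k| ≤ M) : ‖v‖ ≤ √d * M := by
  refine abs_le_of_sq_le_sq' ?_ (by positivity) |>.2
  rw [EuclideanSpace.real_norm_sq_eq, mul_pow, Real.sq_sqrt (by positivity)]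
  calc ∑ k, v k ^ 2 ≤ ∑ _k : Fin d, M ^ 2 :=
        Finset.sum_le_sum fun k _ => sq_le_sq' (abs_le.mp (hv k)).1 (abs_le.mp (hv k)).2
    _ = _ := by simp

lemma l2_opNorm_le_of_row_le (Y : Matrix (Fin n) (Fin d) ℝ) {b : ℝ} (hb : 0 ≤ b)
    (hY : ∀ i, ‖WithLp.toLp 2 (Y i)‖ ≤ b) : ‖Y‖ ≤ √n * b := by
  refine Matrix.l2_opNorm_le_of_mulVec (by positivity) fun v => ?_
  rw [mul_assoc]
  refine norm_le_sqrt_mul_of_abs_le _ (by positivity) fun i => ?_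
  refine (abs_dotProduct_le_norm (Y i) v.ofLp).trans ?_
  gcongr
  exact hY i

/-- On the event that the Gram matrix of the latent positions is well conditioned, the centered
adjacency matrix has small norm and small products with the latent positions, the embedding error
is small. -/
lemma embeddingErrorBound_of_spectral (hd : 1 ≤ d) {r : ℝ} (hr0 : 0 < r) (hr1 : r ≤ 1)
    {x : Fin n → EuclideanSpace ℝ (Fin d)} (hx : ∀ i, ‖x i‖ ≤ 1) {g : EdgeIdx n → Bool}
    {δ K l q : ℝ} (hK : 0 ≤ K) (hδ : 0 < δ) (hl : 1 ≤ l) (hlog : l ^ 2 = Real.log n)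
    (hq : q = √(n * r)) (hlq : l ^ 2 ≤ q)
    (hG : ∀ u : Fin d → ℝ, δ * n * (u ⬝ᵥ u) ≤
      u ⬝ᵥ (((Matrix.of fun i k => x i k)ᵀ * Matrix.of fun i k => x i k) *ᵥ u))
    (hH : ‖hollowMatrix (centeredBit (edgeProb r x) g)‖ ≤ K * q * l)
    (hrow : ∀ i k, |∑ j, hollowMatrix (centeredBit (edgeProb r x) g) i j * x j k| ≤ K * √n * l)
    (h1 : 6 * (√d * K + 1) ≤ δ * l) (h2 : 6 * (√d * K + 1) < δ ^ 2 * l)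
    (h3 : rowErrorConst (√d * K + 1) δ ≤ l ^ 2) :
    EmbeddingErrorBound 1 r x (bitAdjacency g) := by
  intro Xhat hXhat
  set H := hollowMatrix (centeredBit (edgeProb r x) g) with hHdef
  set xm : Matrix (Fin n) (Fin d) ℝ := Matrix.of fun i k => x i k with hxm
  set Y : Matrix (Fin n) (Fin d) ℝ := √r • xm with hY
  set K' := √d * K + 1 with hK'
  have hsd : 1 ≤ √(d : ℝ) := Real.one_le_sqrt.mpr (by exact_mod_cast hd)
  have hl2 : 1 ≤ l ^ 2 := one_le_pow₀ hl
  have hq1 : 1 ≤ q := hl2.trans hlq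
  have hq0 : 0 < q := by linarith
  have hq2 : q ^ 2 = n * r := by rw [hq, Real.sq_sqrt (by positivity)]
  have hql : 1 ≤ q * l := one_le_mul_of_one_le_of_one_le hq1 hl
  have hK'0 : 0 < K' := by positivity
  have hsr : √r ≤ 1 := Real.sqrt_le_one.mpr hr1
  have hsqr : √r * √r = r := Real.mul_self_sqrt hr0.le
  have hqs : q = √n * √r := by rw [hq, Real.sqrt_mul (by positivity)]
  have hYYt : ∀ i j, (Y * Yᵀ) i j = r * inner ℝ (x i) (x j) := by
    intro i j
    have : inner ℝ (x i) (x j) = ∑ k, x i k * x j k := by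
      rw [PiLp.inner_apply]
      exact Finset.sum_congr rfl fun k _ => by simp [mul_comm]
    rw [this, Matrix.mul_apply, Finset.mul_sum, ← hsqr]
    refine Finset.sum_congr rfl fun k _ => ?_
    simp only [hY, hxm, Matrix.transpose_apply, Matrix.smul_apply, Matrix.of_apply, smul_eq_mul]
    ring
  -- The adjacency matrix has zero diagonal while Y Yᵀ does not; the discrepancy has norm at most 1
  -- and accounts for the + 1 in K'.
  have hdiff : bitAdjacency g - Y * Yᵀ = H - Matrix.diagonal (fun i => r * ‖x i‖ ^ 2) := by
    ext i j
    rw [Matrix.sub_apply, Matrix.sub_apply, hYYt]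
    by_cases hij : i = j
    · subst hij
      rw [Matrix.diagonal_apply_eq, real_inner_self_eq_norm_sq, hHdef, bitAdjacency,
        hollowMatrix_apply_self, hollowMatrix_apply_self]
    · rw [Matrix.diagonal_apply_ne _ hij, sub_zero, hHdef, centeredBit_bitAdjacency_of_ne _ _ _ hij]
  have hrx : ∀ i, r * ‖x i‖ ^ 2 ≤ 1 := fun i =>
    mul_le_one₀ hr1 (by positivity) (pow_le_one₀ (norm_nonneg _) (hx i))
  have hYi : ∀ i, WithLp.toLp 2 (Y i) = √r • x i := fun i => by
    ext k; simp [hY, hxm]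
  have hYrow' : ∀ i, ‖WithLp.toLp 2 (Y i)‖ ≤ √r := by
    intro i
    rw [hYi, norm_smul, Real.norm_of_nonneg (Real.sqrt_nonneg r)]
    exact mul_le_of_le_one_right (Real.sqrt_nonneg r) (hx i)
  have hYrow : ∀ i, ‖WithLp.toLp 2 (Y i)‖ ≤ 1 := fun i => (hYrow' i).trans hsr
  have hYnorm : ‖Y‖ ≤ q := by
    rw [hqs]
    exact l2_opNorm_le_of_row_le Y (Real.sqrt_nonneg r) hYrow'
  have hσ : ‖bitAdjacency g - Y * Yᵀ‖ ≤ K' * q * l := by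
    rw [hdiff]
    refine (norm_sub_le _ _).trans ?_
    have e1 : ‖(Matrix.diagonal (fun i => r * ‖x i‖ ^ 2) : Matrix (Fin n) (Fin n) ℝ)‖ ≤ 1 := by
      rw [Matrix.l2_opNorm_diagonal]
      refine (pi_norm_le_iff_of_nonneg zero_le_one).mpr fun i => ?_
      rw [Real.norm_of_nonneg (by positivity)]
      exact hrx i
    calc _ ≤ 1 * (K * q * l) + 1 := by rw [one_mul]; exact add_le_add hH e1
      _ ≤ √d * (K * q * l) + q * l := by gcongr
      _ = K' * q * l := by rw [hK']; ring
  have hτ : ∀ i, ‖WithLp.toLp 2 (((bitAdjacency g - Y * Yᵀ) * Y) i)‖ ≤ K' * q * l := by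
    intro i
    have e1 : WithLp.toLp 2 (((bitAdjacency g - Y * Yᵀ) * Y) i) =
        WithLp.toLp 2 ((H * Y) i) - (r * ‖x i‖ ^ 2) • WithLp.toLp 2 (Y i) := by
      rw [hdiff, Matrix.sub_mul]
      ext k
      simp [Matrix.diagonal_mul]
    -- Passing from the d coordinates to the Euclidean norm is the source of √d in K'.
    have e2 : ‖WithLp.toLp 2 ((H * Y) i)‖ ≤ √d * (K * q * l) := by
      refine norm_le_sqrt_mul_of_abs_le _ (by positivity) fun k => ?_
      have : (H * Y) i k = √r * ∑ j, H i j * x j k := by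
        rw [Matrix.mul_apply, Finset.mul_sum]
        refine Finset.sum_congr rfl fun j _ => ?_
        simp only [hY, hxm, Matrix.smul_apply, Matrix.of_apply, smul_eq_mul]
        ring
      change |(H * Y) i k| ≤ _
      rw [this, abs_mul, abs_of_nonneg (Real.sqrt_nonneg r)]
      calc _ ≤ √r * (K * √n * l) := by gcongr; exact hrow i k
        _ = _ := by rw [hqs]; ring
    rw [e1]
    refine (norm_sub_le _ _).trans ?_
    rw [norm_smul, Real.norm_of_nonneg (by positivity : 0 ≤ r * ‖x i‖ ^ 2)]
    calc _ ≤ √d * (K * q * l) + 1 :=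
          add_le_add e2 (mul_le_one₀ (hrx i) (norm_nonneg _) (hYrow i))
      _ ≤ √d * (K * q * l) + q * l := by gcongr
      _ = K' * q * l := by rw [hK']; ring
  have hGram : ∀ u : Fin d → ℝ, δ * q ^ 2 * (u ⬝ᵥ u) ≤ u ⬝ᵥ ((Yᵀ * Y) *ᵥ u) := by
    intro u
    have e1 : Yᵀ * Y = r • (xmᵀ * xm) := by
      rw [hY, Matrix.transpose_smul, Matrix.smul_mul, Matrix.mul_smul, smul_smul, hsqr]
    rw [e1, Matrix.smul_mulVec, dotProduct_smul, smul_eq_mul, hq2]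
    calc _ = r * (δ * n * (u ⬝ᵥ u)) := by ring
      _ ≤ _ := by gcongr; exact hG u
  have hA : (bitAdjacency g).IsHermitian := by
    ext i j
    rw [Matrix.conjTranspose_apply, star_trivial]
    exact hollowMatrix_symm _ j i
  have hsmall : q / (δ * q ^ 2) * (2 * (3 * (K' * q * l))) * (q / (δ * q ^ 2)) < 1 := by
    have e1 : q / (δ * q ^ 2) * (2 * (3 * (K' * q * l))) * (q / (δ * q ^ 2)) =
        6 * K' * l / (δ ^ 2 * q) := by
      field_simp
      ring
    rw [e1, div_lt_one (by positivity)]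
    calc 6 * K' * l < δ ^ 2 * l * l := by gcongr
      _ = δ ^ 2 * l ^ 2 := by ring
      _ ≤ δ ^ 2 * q := by gcongr
  have hgap : 6 * (K' * q * l) ≤ δ * q ^ 2 := by
    calc 6 * (K' * q * l) = (6 * K') * (q * l) := by ring
      _ ≤ δ * l * (q * l) := by gcongr
      _ = δ * q * l ^ 2 := by ring
      _ ≤ δ * q * q := by gcongr
      _ = _ := by ring
  set Xh : Matrix (Fin n) (Fin d) ℝ := Matrix.of fun i k => Xhat i k with hXh
  obtain ⟨W, hW, hWrow⟩ := ase_row_bound hA (Xh := Xh) hXhat (by positivity) hGram hYnorm hYrow hσ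
    hgap hτ hsmall
  -- Positions are rows of Y, so right multiplication by W acts on each of them as Wᵀ.
  have hWt : Wᵀ ∈ Matrix.orthogonalGroup (Fin d) ℝ := by
    rw [Matrix.mem_orthogonalGroup_iff, Matrix.transpose_transpose]
    exact mul_eq_one_comm.mp ((Matrix.mem_orthogonalGroup_iff _ _).mp hW)
  refine ⟨Wᵀ, hWt, fun i => ?_⟩
  have e1 : Xhat i - √r • Matrix.toEuclideanLin Wᵀ (x i) = WithLp.toLp 2 ((Xh - Y * W) i) := by
    ext k
    simp only [PiLp.sub_apply, PiLp.smul_apply, Matrix.sub_apply, hXh, Matrix.of_apply, smul_eq_mul,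
      Matrix.ofLp_toLpLin, Matrix.toLin'_apply, Matrix.mulVec, dotProduct, Matrix.mul_apply, hY,
      Matrix.smul_apply, hxm, Matrix.transpose_apply, Finset.mul_sum]
    congr 1
    exact Finset.sum_congr rfl fun j _ => by ring
  rw [e1]
  refine (hWrow i).trans ((row_error_le hK'0.le hδ hq0 hl).trans ?_)
  rw [← hq, ← hlog]
  refine div_le_div_of_nonneg_right ?_ hq0.le
  -- The spare logarithm l² absorbs the constant.
  calc rowErrorConst K' δ * l ^ 2 ≤ l ^ 2 * l ^ 2 := by gcongr
    _ = 1 * 1 * (l ^ 2) ^ 2 := by ring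
    _ ≤ 1 * √d * (l ^ 2) ^ 2 := by gcongr

/-- In the sparse regime it suffices to bound the degrees. -/
lemma embeddingErrorBound_of_degree (hd : 1 ≤ d) {r : ℝ} (hr0 : 0 < r) (hr1 : r ≤ 1) (hn : 0 < n)
    {x : Fin n → EuclideanSpace ℝ (Fin d)} (hx : ∀ i, ‖x i‖ ≤ 1) {a : Matrix (Fin n) (Fin n) ℝ}
    (ha : IsAdjacency a) {L D : ℝ} (hL : L = Real.log n) (hL1 : 1 ≤ L) (hsparse : n * r ≤ L ^ 2)
    (hdeg : ∀ i, ∑ j, a i j ≤ D) (hD : D ≤ (L - 1) ^ 4) : EmbeddingErrorBound 1 r x a := by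
  intro Xhat hXhat
  refine ⟨1, Submonoid.one_mem _, fun i => ?_⟩
  have hsd : 1 ≤ √(d : ℝ) := Real.one_le_sqrt.mpr (by exact_mod_cast hd)
  have h1 : ‖Xhat i‖ ≤ L - 1 :=
    le_of_pow_le_pow_left₀ (by norm_num : 4 ≠ 0) (by linarith)
      ((hXhat.norm_pow_four_le ha i).trans ((hdeg i).trans hD))
  have h2 : ‖√r • Matrix.toEuclideanLin (1 : Matrix (Fin d) (Fin d) ℝ) (x i)‖ ≤ 1 := by
    rw [norm_smul, Real.norm_of_nonneg (Real.sqrt_nonneg r)]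
    refine mul_le_one₀ (Real.sqrt_le_one.mpr hr1) (norm_nonneg _) ?_
    simpa using hx i
  have hm : (0 : ℝ) < n * r := by positivity
  -- Hence the target is at least L, which exceeds the sum of the two norms; no alignment is needed.
  have hs : √(n * r) ≤ L := Real.sqrt_le_iff.mpr ⟨by linarith, hsparse⟩
  rw [← hL, le_div_iff₀ (Real.sqrt_pos.mpr hm)]
  calc _ ≤ L * L := by
        gcongr
        refine (norm_sub_le _ _).trans ?_
        linarith
    _ = 1 * 1 * L ^ 2 := by ring
    _ ≤ 1 * √d * L ^ 2 := by gcongr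

end Deterministic

/-! ### Probabilities of the bad events. -/

section BadEvents

variable {n d : ℕ} {r : ℝ}

lemma edgeProb_mem_Icc (hr0 : 0 < r) (hr1 : r ≤ 1) {x : Fin n → EuclideanSpace ℝ (Fin d)}
    (hx : ∀ i j, inner ℝ (x i) (x j) ∈ Set.Icc (0 : ℝ) 1) (e : EdgeIdx n) :
    edgeProb r x e ∈ Set.Icc (0 : ℝ) 1 :=
  ⟨mul_nonneg hr0.le (hx _ _).1, mul_le_one₀ hr1 (hx _ _).1 (hx _ _).2⟩

lemma edgeProb_le (hr0 : 0 < r) {x : Fin n → EuclideanSpace ℝ (Fin d)}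
    (hx : ∀ i j, inner ℝ (x i) (x j) ∈ Set.Icc (0 : ℝ) 1) (e : EdgeIdx n) :
    edgeProb r x e ≤ r :=
  mul_le_of_le_one_right hr0.le (hx _ _).2

lemma continuous_hollowMatrix_centeredBit (r : ℝ) (g : EdgeIdx n → Bool) :
    Continuous fun x : Fin n → EuclideanSpace ℝ (Fin d) =>
      hollowMatrix (centeredBit (edgeProb r x) g) := by
  refine continuous_matrix fun i j => ?_
  by_cases h : i = j
  · subst h
    simp only [hollowMatrix_apply_self]
    exact continuous_const
  · simp only [hollowMatrix_apply_of_ne _ h, centeredBit, edgeProb]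
    fun_prop

lemma sum_bitAdjacency_le (hr0 : 0 < r) {x : Fin n → EuclideanSpace ℝ (Fin d)}
    (hx : ∀ i j, inner ℝ (x i) (x j) ∈ Set.Icc (0 : ℝ) 1) (g : EdgeIdx n → Bool) (i : Fin n) :
    ∑ j, bitAdjacency g i j ≤
      n * r + ∑ j, hollowMatrix (centeredBit (edgeProb r x) g) i j * 1 := by
  calc ∑ j, bitAdjacency g i j
      ≤ ∑ j, (r + hollowMatrix (centeredBit (edgeProb r x) g) i j * 1) := by
        refine Finset.sum_le_sum fun j _ => ?_
        by_cases h : i = j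
        · subst h
          rw [bitAdjacency, hollowMatrix_apply_self, hollowMatrix_apply_self]
          linarith
        · rw [centeredBit_bitAdjacency_of_ne _ _ _ h]
          have := mul_le_of_le_one_right hr0.le (hx i j).2
          linarith
    _ = _ := by simp [Finset.sum_add_distrib]

variable {Ω : Type*} [MeasurableSpace Ω] {μ : Measure Ω} [IsProbabilityMeasure μ]
  {F : Measure (EuclideanSpace ℝ (Fin d))}
  {X : Ω → Fin n → EuclideanSpace ℝ (Fin d)} {A : Ω → Matrix (Fin n) (Fin n) ℝ}

lemma IsRDPG.measureReal_trace_le (h : IsRDPG μ F r X A) (hr0 : 0 < r) (hr1 : r ≤ 1)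
    (hin : ∀ᵐ ω ∂μ, ∀ i j, inner ℝ (X ω i) (X ω j) ∈ Set.Icc (0 : ℝ) 1) {k : ℕ} (hk : 0 < k)
    (hkn : 2 * k ≤ n * r) {s : ℝ} (hs : 0 < s) :
    μ.real {ω | s ≤ (hollowMatrix (centeredBit (edgeProb r (X ω)) (edgeBits (A ω))) ^
      (2 * k)).trace} ≤ n * (8 * k * (n * r)) ^ k / s := by
  refine h.measureReal_le (S := fun x => {g | s ≤
    (hollowMatrix (centeredBit (edgeProb r x) g) ^ (2 * k)).trace}) (fun g => ?_) ?_
  · exact measurableSet_le measurable_const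
      ((continuous_hollowMatrix_centeredBit r g).pow _).matrix_trace.measurable
  · filter_upwards [hin] with ω hω
    refine bernoulliProb_le_div (edgeProb_mem_Icc hr0 hr1 hω)
      (f := fun g => (hollowMatrix (centeredBit (edgeProb r (X ω)) g) ^ (2 * k)).trace)
      (fun g => ?_) hs (sum_bernoulliWeight_mul_trace_le (edgeProb_mem_Icc hr0 hr1 hω) hr1
        (edgeProb_le hr0 hω) hk hkn)
    have hH : (hollowMatrix (centeredBit (edgeProb r (X ω)) g))ᵀ =
        hollowMatrix (centeredBit (edgeProb r (X ω)) g) := by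
      ext i j
      exact hollowMatrix_symm _ j i
    set H := hollowMatrix (centeredBit (edgeProb r (X ω)) g)
    have : H ^ (2 * k) = (H ^ k)ᴴ * H ^ k := by
      rw [Matrix.conjTranspose_eq_transpose_of_trivial, Matrix.transpose_pow, hH, ← pow_add,
        two_mul]
    rw [this]
    exact (Matrix.posSemidef_conjTranspose_mul_self (H ^ k)).trace_nonneg

lemma IsRDPG.measureReal_row_le (h : IsRDPG μ F r X A) (hr0 : 0 < r) (hr1 : r ≤ 1)
    (hin : ∀ᵐ ω ∂μ, ∀ i j, inner ℝ (X ω i) (X ω j) ∈ Set.Icc (0 : ℝ) 1) {t : ℝ} (ht0 : 0 ≤ t)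
    (ht1 : t ≤ 1) (s : ℝ) :
    μ.real {ω | ∃ i k, s ≤ |∑ j, hollowMatrix (centeredBit (edgeProb r (X ω)) (edgeBits (A ω))) i j
      * X ω j k|} ≤ n * (d * (2 * Real.exp (t ^ 2 * (r * n) - t * s))) := by
  -- The Boolean is a sign: it splits the absolute value into two one-sided Chernoff events.
  let v : (Fin n → EuclideanSpace ℝ (Fin d)) → Fin d → Bool → Fin n → ℝ := fun x k b j =>
    if b then x j k else -x j k
  have hset : {ω | ∃ i k, s ≤ |∑ j, hollowMatrix (centeredBit (edgeProb r (X ω))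
      (edgeBits (A ω))) i j * X ω j k|} = {ω | edgeBits (A ω) ∈ ⋃ i, ⋃ k, ⋃ b,
        {g | s ≤ ∑ j, hollowMatrix (centeredBit (edgeProb r (X ω)) g) i j * v (X ω) k b j}} := by
    ext ω
    simp only [Set.mem_iUnion, Set.mem_ofPred_eq, Bool.exists_bool, v, Bool.false_eq_true, if_false,
      if_true, mul_neg, Finset.sum_neg_distrib, le_abs]
    simp only [or_comm]
  rw [hset]
  refine h.measureReal_le (S := fun x => ⋃ i, ⋃ k, ⋃ b,
    {g | s ≤ ∑ j, hollowMatrix (centeredBit (edgeProb r x) g) i j * v x k b j}) (fun g => ?_) ?_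
  · have : {x : Fin n → EuclideanSpace ℝ (Fin d) | g ∈ ⋃ i, ⋃ k, ⋃ b,
        {g | s ≤ ∑ j, hollowMatrix (centeredBit (edgeProb r x) g) i j * v x k b j}} =
        ⋃ i, ⋃ k, ⋃ b,
        {x | s ≤ ∑ j, hollowMatrix (centeredBit (edgeProb r x) g) i j * v x k b j} := by
      ext x
      simp only [Set.mem_iUnion, Set.mem_ofPred_eq]
    rw [this]
    refine MeasurableSet.iUnion fun i => MeasurableSet.iUnion fun k => MeasurableSet.iUnion fun b =>
      measurableSet_le measurable_const (Continuous.measurable ?_)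
    refine continuous_finsetSum _ fun j _ =>
      ((continuous_hollowMatrix_centeredBit r g).matrix_elem i j).mul ?_
    cases b
    · simp only [v, Bool.false_eq_true, if_false]; fun_prop
    · simp only [v, if_true]; fun_prop
  · filter_upwards [hin] with ω hω
    have hp := edgeProb_mem_Icc hr0 hr1 hω
    have hv : ∀ k b j, |v (X ω) k b j| ≤ 1 := by
      intro k b j
      have h1 : |X ω j k| ≤ 1 := by
        refine (PiLp.norm_apply_le (X ω j) k).trans ?_
        have := (hω j j).2
        rw [real_inner_self_eq_norm_sq] at this
        exact (sq_le_one_iff₀ (norm_nonneg _)).mp this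
      cases b
      · simpa [v] using h1
      · simpa [v] using h1
    have := bernoulliProb_iUnion_le hp fun i : Fin n => bernoulliProb_iUnion_le hp
      fun k : Fin d => bernoulliProb_iUnion_le hp fun b : Bool =>
        bernoulliProb_row_le hp hr0.le (edgeProb_le hr0 hω) i (hv k b) ht0 ht1 s
    simpa using this

lemma IsRDPG.measureReal_degree_le (h : IsRDPG μ F r X A) (hr0 : 0 < r) (hr1 : r ≤ 1)
    (hin : ∀ᵐ ω ∂μ, ∀ i j, inner ℝ (X ω i) (X ω j) ∈ Set.Icc (0 : ℝ) 1) (s : ℝ) :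
    μ.real {ω | ∃ i, s ≤ ∑ j, A ω i j} ≤ n * Real.exp (2 * (n * r) - s) := by
  have hset : {ω | ∃ i, s ≤ ∑ j, A ω i j} ⊆
      {ω | edgeBits (A ω) ∈ ⋃ i, {g | s ≤ ∑ j, bitAdjacency g i j}} := by
    rintro ω ⟨i, hi⟩
    refine Set.mem_iUnion.mpr ⟨i, ?_⟩
    change s ≤ ∑ j, bitAdjacency (edgeBits (A ω)) i j
    rwa [(h.isAdjacency ω).bitAdjacency_edgeBits]
  refine (measureReal_mono hset).trans ?_
  refine h.measureReal_le (S := fun _ => ⋃ i, {g | s ≤ ∑ j, bitAdjacency g i j}) (fun g => ?_) ?_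
  · exact MeasurableSet.const _
  · filter_upwards [hin] with ω hω
    have hp := edgeProb_mem_Icc hr0 hr1 hω
    have h1 : ∀ i : Fin n, bernoulliProb (edgeProb r (X ω)) {g | s ≤ ∑ j, bitAdjacency g i j} ≤
        Real.exp (2 * (n * r) - s) := by
      intro i
      -- Chernoff with t = 1: the exponent is nr - (s - nr), the mean degree being at most nr.
      have h2 := bernoulliProb_row_le hp hr0.le (edgeProb_le hr0 hω) i (a := fun _ => 1)
        (by simp) zero_le_one le_rfl (s - n * r)
      have h3 : bernoulliProb (edgeProb r (X ω)) {g | s ≤ ∑ j, bitAdjacency g i j} ≤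
          bernoulliProb (edgeProb r (X ω)) {g | s - n * r ≤
            ∑ j, hollowMatrix (centeredBit (edgeProb r (X ω)) g) i j * 1} := by
        refine Finset.sum_le_sum fun g _ =>
          mul_le_mul_of_nonneg_left ?_ (bernoulliWeight_nonneg hp g)
        refine Set.indicator_le_indicator_of_subset (fun g hg => ?_) (fun _ => zero_le_one) g
        have h4 := sum_bitAdjacency_le hr0 hω g i
        have h5 : s ≤ ∑ j, bitAdjacency g i j := hg
        change s - n * r ≤ _
        linarith
      refine h3.trans (h2.trans (le_of_eq ?_))
      congr 1
      ring
    simpa using bernoulliProb_iUnion_le hp h1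

end BadEvents

/-! ### Choice of parameters in the two regimes and the conclusion. -/

section Asymptotics

lemma measureReal_not_eq_zero {Ω : Type*} [MeasurableSpace Ω] {μ : Measure Ω} {P : Ω → Prop}
    (h : ∀ᵐ ω ∂μ, P ω) : μ.real {ω | ¬P ω} = 0 := by
  rw [Measure.real, ae_iff.mp h, ENNReal.toReal_zero]

variable {n d : ℕ} {r : ℝ} {Ω : Type*} [MeasurableSpace Ω] {μ : Measure Ω}
  [IsProbabilityMeasure μ] {F : Measure (EuclideanSpace ℝ (Fin d))}
  {X : Ω → Fin n → EuclideanSpace ℝ (Fin d)} {A : Ω → Matrix (Fin n) (Fin n) ℝ}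

/-- Supplies the exponent of the trace method: a power of two of order log n. -/
lemma exists_two_pow_between {L : ℝ} (hL : 1 ≤ L) : ∃ j : ℕ, L ≤ 2 ^ j ∧ (2 : ℝ) ^ j ≤ 2 * L := by
  obtain ⟨j, h1, h2⟩ := exists_nat_pow_near hL (one_lt_two)
  exact ⟨j + 1, h2.le, by rw [pow_succ]; linarith⟩

lemma natCast_rpow_eq_exp_log_mul (hn : 0 < n) (a : ℝ) :
    (n : ℝ) ^ a = Real.exp (a * Real.log n) := by
  rw [Real.rpow_def_of_pos (by exact_mod_cast hn), mul_comm]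

lemma norm_le_one_of_inner_mem {x : EuclideanSpace ℝ (Fin d)}
    (hx : inner ℝ x x ∈ Set.Icc (0 : ℝ) 1) : ‖x‖ ≤ 1 := by
  have := hx.2
  rw [real_inner_self_eq_norm_sq] at this
  exact (sq_le_one_iff₀ (norm_nonneg _)).mp this

lemma IsRDPG.measureReal_not_bound_of_sparse (h : IsRDPG μ F r X A) (hr0 : 0 < r) (hr1 : r ≤ 1)
    (hin : ∀ᵐ ω ∂μ, ∀ i j, inner ℝ (X ω i) (X ω j) ∈ Set.Icc (0 : ℝ) 1) (hd : 1 ≤ d) (hn : 0 < n)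
    {c : ℝ} (hL : 1 ≤ Real.log n) (hsparse : n * r ≤ Real.log n ^ 2)
    (hnum : 2 * Real.log n ^ 2 + (c + 1) * Real.log n ≤ (Real.log n - 1) ^ 4) :
    μ.real {ω | ¬EmbeddingErrorBound 1 r (X ω) (A ω)} ≤ (n : ℝ) ^ (-c) := by
  set L := Real.log n with hLdef
  -- Chosen so that the degree bound n exp(2nr - D) is exactly n^(-c).
  set D := 2 * (n * r) + (c + 1) * L with hD
  have hsub : {ω | ¬EmbeddingErrorBound 1 r (X ω) (A ω)} ⊆
      {ω | ¬∀ i j, inner ℝ (X ω i) (X ω j) ∈ Set.Icc (0 : ℝ) 1} ∪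
        {ω | ∃ i, D ≤ ∑ j, A ω i j} := by
    intro ω hω
    by_contra hcon
    simp only [Set.mem_union, Set.mem_ofPred_eq, not_or, not_not, not_exists, not_le] at hcon
    exact hω (embeddingErrorBound_of_degree hd hr0 hr1 hn
      (fun i => norm_le_one_of_inner_mem (hcon.1 i i)) (h.isAdjacency ω) hLdef hL hsparse
      (fun i => (hcon.2 i).le) (by linarith))
  refine (measureReal_mono hsub).trans ((measureReal_union_le _ _).trans ?_)
  rw [measureReal_not_eq_zero hin, zero_add]
  refine (h.measureReal_degree_le hr0 hr1 hin D).trans (le_of_eq ?_)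
  have : (n : ℝ) = Real.exp L := (Real.exp_log (by exact_mod_cast hn)).symm
  rw [natCast_rpow_eq_exp_log_mul hn, ← hLdef]
  nth_rw 1 [this]
  rw [← Real.exp_add]
  congr 1
  rw [hD]
  ring

/-- The constant in the bounds on the centered adjacency matrix that hold with probability
`1 - O(n ^ (-(c + 1)))`. -/
noncomputable def noiseConst (c : ℝ) : ℝ := c + 4 + 4 * Real.exp ((c + 2) / 2)

-- The root of order 2^j is taken in the trace bound. As 2^j ≥ log n, the factor n^(c+2) costs only
-- e^(c+2); as 2^j ≤ 2 log n, the factor 8·2^j costs only 16 log n.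
open scoped Matrix.Norms.L2Operator in
lemma l2_opNorm_hollowMatrix_le (hn : 0 < n) {c m : ℝ} (hc : 0 < c) (hm : 0 < m) {j : ℕ}
    (hj : Real.log n ≤ 2 ^ j) (hj' : (2 : ℝ) ^ j ≤ 2 * Real.log n) {b : EdgeIdx n → ℝ}
    (htr : (hollowMatrix b ^ (2 * 2 ^ j)).trace < (n : ℝ) ^ (c + 2) * (8 * 2 ^ j * m) ^ 2 ^ j) :
    ‖hollowMatrix b‖ ≤ noiseConst c * √m * √(Real.log n) := by
  have hL0 : 0 ≤ Real.log n := Real.log_natCast_nonneg n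
  have hH : (hollowMatrix b).IsHermitian := by
    ext i j
    rw [Matrix.conjTranspose_apply, star_trivial]
    exact hollowMatrix_symm _ j i
  have hK : 0 ≤ noiseConst c := by rw [noiseConst]; positivity
  have h1 := (l2_opNorm_pow_le_trace hH j).trans htr.le
  refine le_of_pow_le_pow_left₀ (n := 2 * 2 ^ j) (by positivity) (by positivity) (h1.trans ?_)
  have hsq : (noiseConst c * √m * √(Real.log n)) ^ 2 = noiseConst c ^ 2 * m * Real.log n := by
    rw [mul_pow, mul_pow, Real.sq_sqrt hm.le, Real.sq_sqrt hL0]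
  rw [pow_mul (noiseConst c * √m * √(Real.log n)), hsq]
  have hK2 : 16 * Real.exp (c + 2) ≤ noiseConst c ^ 2 := by
    have e1 : 4 * Real.exp ((c + 2) / 2) ≤ noiseConst c := by rw [noiseConst]; linarith
    calc 16 * Real.exp (c + 2) = (4 * Real.exp ((c + 2) / 2)) ^ 2 := by
          rw [mul_pow, ← Real.exp_nat_mul]
          norm_num
          ring_nf
      _ ≤ _ := by gcongr
  calc (n : ℝ) ^ (c + 2) * (8 * 2 ^ j * m) ^ 2 ^ j
      ≤ Real.exp (c + 2) ^ 2 ^ j * (8 * (2 * Real.log n) * m) ^ 2 ^ j := by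
        gcongr
        rw [natCast_rpow_eq_exp_log_mul hn, ← Real.exp_nat_mul, Real.exp_le_exp, mul_comm]
        push_cast
        gcongr
    _ = (16 * Real.exp (c + 2) * m * Real.log n) ^ 2 ^ j := by
        rw [← mul_pow]
        congr 1
        ring
    _ ≤ _ := by gcongr

lemma IsRDPG.measureReal_not_bound_of_dense (h : IsRDPG μ F r X A) (hr0 : 0 < r) (hr1 : r ≤ 1)
    (hin : ∀ᵐ ω ∂μ, ∀ i j, inner ℝ (X ω i) (X ω j) ∈ Set.Icc (0 : ℝ) 1)
    (hF : ∀ᵐ x ∂F, ‖x‖ ≤ 1) (hd : 1 ≤ d) {δ : ℝ} (hδ : 0 < δ)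
    (hM : ∀ u : Fin d → ℝ, 2 * δ * (u ⬝ᵥ u) ≤ u ⬝ᵥ (secondMoment F *ᵥ u))
    {c : ℝ} (hc : 0 < c) (hL : 4 ≤ Real.log n) (hdense : Real.log n ^ 2 ≤ n * r)
    (hn3 : 3 ≤ n) (hnd : 2 * d ≤ n)
    (hgram : d * (d * (2 * Real.exp (-(n * (δ / d) ^ 2) / 2))) ≤ (n : ℝ) ^ (-(c + 1)))
    (h1 : 6 * (√d * noiseConst c + 1) ≤ δ * √(Real.log n))
    (h2 : 6 * (√d * noiseConst c + 1) < δ ^ 2 * √(Real.log n))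
    (h3 : rowErrorConst (√d * noiseConst c + 1) δ ≤ Real.log n) :
    μ.real {ω | ¬EmbeddingErrorBound 1 r (X ω) (A ω)} ≤ (n : ℝ) ^ (-c) := by
  set L := Real.log n with hLdef
  set l := √L with hl
  set K := noiseConst c with hK
  have hn0 : 0 < n := by omega
  have hn0' : (0 : ℝ) < n := by exact_mod_cast hn0
  have hnexp : (n : ℝ) = Real.exp L := (Real.exp_log hn0').symm
  have hd0 : (0 : ℝ) < d := by exact_mod_cast hd
  have hK0 : 0 ≤ K := by rw [hK, noiseConst]; positivity
  have hl2 : l ^ 2 = L := Real.sq_sqrt (by linarith)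
  have hl1 : 1 ≤ l := Real.one_le_sqrt.mpr (by linarith)
  have hm : 0 < n * r := by positivity
  obtain ⟨j, hj, hj'⟩ := exists_two_pow_between (L := L) (by linarith)
  -- The factor n^(c+2) makes Markov's inequality give n^(-(c+1)) despite the factor n in the
  -- expected trace.
  set s₁ := (n : ℝ) ^ (c + 2) * (8 * 2 ^ j * (n * r)) ^ 2 ^ j with hs₁
  set s₂ := K * √n * l with hs₂
  set H : Ω → Matrix (Fin n) (Fin n) ℝ := fun ω =>
    hollowMatrix (centeredBit (edgeProb r (X ω)) (edgeBits (A ω))) with hH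
  have hsub : {ω | ¬EmbeddingErrorBound 1 r (X ω) (A ω)} ⊆
      ({ω | ¬∀ i j, inner ℝ (X ω i) (X ω j) ∈ Set.Icc (0 : ℝ) 1} ∪
        {ω | ∃ j k, n * (δ / d) ≤ |∑ i, X ω i j * X ω i k - n * secondMoment F j k|}) ∪
      ({ω | s₁ ≤ (H ω ^ (2 * 2 ^ j)).trace} ∪ {ω | ∃ i k, s₂ ≤ |∑ j, H ω i j * X ω j k|}) := by
    intro ω hω
    by_contra hcon
    simp only [Set.mem_union, Set.mem_ofPred_eq, not_or, not_not, not_exists, not_le] at hcon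
    obtain ⟨⟨g1, g2⟩, g3, g4⟩ := hcon
    refine hω ?_
    rw [← (h.isAdjacency ω).bitAdjacency_edgeBits]
    refine embeddingErrorBound_of_spectral hd hr0 hr1
      (fun i => norm_le_one_of_inner_mem (g1 i i)) hK0 hδ hl1 hl2 rfl ?_ ?_
      (l2_opNorm_hollowMatrix_le hn0 hc hm hj hj' g3) (fun i k => (g4 i k).le) h1 h2
      (by rw [hl2]; exact h3)
    · rw [hl2]
      exact Real.le_sqrt_of_sq_le hdense
    · exact gram_ge_of_entries (ε := δ / d) (by positivity) hM
        (by rw [mul_div_cancel₀ _ hd0.ne']) fun j k => (g2 j k).le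
  -- 2·2^j ≤ 4L ≤ L² ≤ nr; this is where L ≥ 4 is needed.
  have hkn : 2 * ((2 ^ j : ℕ) : ℝ) ≤ n * r := by
    push_cast
    nlinarith
  have b1 : μ.real {ω | s₁ ≤ (H ω ^ (2 * 2 ^ j)).trace} ≤ (n : ℝ) ^ (-(c + 1)) := by
    have hs₁0 : 0 < s₁ := by positivity
    refine (h.measureReal_trace_le hr0 hr1 hin (k := 2 ^ j) (by positivity) hkn hs₁0).trans
      (le_of_eq ?_)
    push_cast
    rw [hs₁, mul_div_mul_right _ _ (by positivity), show c + 2 = (c + 1) + 1 by ring,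
      Real.rpow_add hn0', Real.rpow_one, Real.rpow_neg hn0'.le]
    field_simp
  have b2 : μ.real {ω | ∃ i k, s₂ ≤ |∑ j, H ω i j * X ω j k|} ≤ (n : ℝ) ^ (-(c + 1)) := by
    have hsn : 0 < √(n : ℝ) := Real.sqrt_pos.mpr hn0'
    have hln : l ≤ √n := Real.sqrt_le_sqrt (Real.log_le_self hn0'.le)
    -- With this t the exponent is at most L - KL. As K ≥ c + 4 it beats the n² coming from the
    -- union bound with 2d ≤ n.
    refine (h.measureReal_row_le hr0 hr1 hin (t := l / √n) (by positivity)
      ((div_le_one hsn).mpr hln) s₂).trans ?_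
    have e1 : (l / √n) ^ 2 * (r * n) = L * r := by
      rw [div_pow, hl2, Real.sq_sqrt hn0'.le]
      field_simp
    have e2 : l / √n * s₂ = K * L := by
      rw [hs₂, ← hl2]
      field_simp
    rw [e1, e2]
    have hKc : c + 4 ≤ K := by
      rw [hK, noiseConst]
      have := Real.exp_pos ((c + 2) / 2)
      linarith
    calc (n : ℝ) * (d * (2 * Real.exp (L * r - K * L)))
        = n * ((2 * d) * Real.exp (L * r - K * L)) := by ring
      _ ≤ n * (n * Real.exp (L * 1 - (c + 4) * L)) := by
          gcongr
          exact_mod_cast hnd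
      _ = (n : ℝ) ^ (-(c + 1)) := by
          rw [natCast_rpow_eq_exp_log_mul hn0, ← hLdef]
          nth_rw 1 2 [hnexp]
          rw [← Real.exp_add, ← Real.exp_add]
          congr 1
          ring
  have b3 := (h.measureReal_gram_le hF (ε := δ / d) (by positivity)).trans hgram
  calc μ.real {ω | ¬EmbeddingErrorBound 1 r (X ω) (A ω)}
      ≤ (0 + (n : ℝ) ^ (-(c + 1))) + ((n : ℝ) ^ (-(c + 1)) + (n : ℝ) ^ (-(c + 1))) := by
        refine (measureReal_mono hsub).trans ((measureReal_union_le _ _).trans ?_)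
        refine add_le_add ((measureReal_union_le _ _).trans ?_)
          ((measureReal_union_le _ _).trans (add_le_add b1 b2))
        rw [measureReal_not_eq_zero hin]
        exact add_le_add le_rfl b3
    _ = 3 * (n : ℝ) ^ (-(c + 1)) := by ring
    _ ≤ n * (n : ℝ) ^ (-(c + 1)) := by
        gcongr
        exact_mod_cast hn3
    _ = (n : ℝ) ^ (-c) := by
        nth_rw 1 [← Real.rpow_one (n : ℝ)]
        rw [← Real.rpow_add hn0']
        congr 1
        ring

lemma eventually_mul_exp_le_rpow (a b c : ℝ) (hb : 0 < b) :
    ∀ᶠ n : ℕ in Filter.atTop, a * Real.exp (-(b * n)) ≤ (n : ℝ) ^ (-c) := by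
  have h1 := ((tendsto_rpow_mul_exp_neg_mul_atTop_nhds_zero c b hb).const_mul a).comp
    tendsto_natCast_atTop_atTop
  rw [mul_zero] at h1
  filter_upwards [h1.eventually (gt_mem_nhds one_pos), Filter.eventually_gt_atTop 0] with n h2 hn
  have hn' : (0 : ℝ) < n := by exact_mod_cast hn
  simp only [Function.comp_apply] at h2
  rw [Real.rpow_neg hn'.le, ← one_div, le_div_iff₀ (by positivity)]
  refine le_trans (le_of_eq ?_) h2.le
  rw [neg_mul]
  ring

lemma embeddingErrorBound_of_dim_zero (x : Fin n → EuclideanSpace ℝ (Fin 0))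
    (a : Matrix (Fin n) (Fin n) ℝ) : EmbeddingErrorBound 1 r x a := by
  intro Xhat _
  refine ⟨1, Submonoid.one_mem _, fun i => ?_⟩
  rw [Subsingleton.elim (Xhat i - _) 0, norm_zero]
  positivity

end Asymptotics

/-! ### Assembly of the two regimes. -/

theorem mainTheorem2 :
    ∃ C : ℝ, 0 < C ∧
      ∀ (d : ℕ) (𝒳 : Set (EuclideanSpace ℝ (Fin d)))
        (F : Measure (EuclideanSpace ℝ (Fin d))) [IsProbabilityMeasure F]
        (ρ : ℕ → ℝ) (Ω : ℕ → Type*) [∀ n, MeasurableSpace (Ω n)]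
        (μ : ∀ n, Measure (Ω n)) [∀ n, IsProbabilityMeasure (μ n)]
        (X : ∀ n, Ω n → Fin n → EuclideanSpace ℝ (Fin d))
        (A : ∀ n, Ω n → Matrix (Fin n) (Fin n) ℝ),
        (∀ x ∈ 𝒳, ∀ y ∈ 𝒳, inner ℝ x y ∈ Set.Icc (0 : ℝ) 1) →
        (∀ᵐ x ∂F, x ∈ 𝒳) →
        (secondMoment F).rank = d →
        (∀ n, 0 < ρ n ∧ ρ n ≤ 1) →
        (∀ n, IsRDPG (μ n) F (ρ n) (X n) (A n)) →
        AsympAlmostSurely μ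
          (fun n => {ω | EmbeddingErrorBound C (ρ n) (X n ω) (A n ω)}) := by
  refine ⟨1, one_pos, ?_⟩
  intro d 𝒳 F _ ρ Ω _ μ _ X A h𝒳 hF𝒳 hrank hρ hR c hc
  suffices hev : ∀ᶠ n : ℕ in Filter.atTop,
      (μ n).real {ω | ¬EmbeddingErrorBound 1 (ρ n) (X n ω) (A n ω)} ≤ (n : ℝ) ^ (-c) by
    obtain ⟨n₀, hn₀⟩ := Filter.eventually_atTop.mp hev
    refine ⟨n₀, fun n hn η hη _ => ?_⟩
    have h1 := hn₀ n hn.le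
    -- Subadditivity alone suffices, so measurability of the event is never required.
    have h2 : (1 : ℝ) ≤ (μ n).real {ω | EmbeddingErrorBound 1 (ρ n) (X n ω) (A n ω)} +
        (μ n).real {ω | ¬EmbeddingErrorBound 1 (ρ n) (X n ω) (A n ω)} := by
      refine le_trans (le_of_eq ?_) (measureReal_union_le _ _)
      rw [← probReal_univ (μ := μ n)]
      congr 1
      ext ω
      simp [em]
    linarith
  rcases Nat.eq_zero_or_pos d with rfl | hd
  · refine Filter.Eventually.of_forall fun n => ?_
    have : {ω | ¬EmbeddingErrorBound 1 (ρ n) (X n ω) (A n ω)} = ∅ := by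
      ext ω
      simp [embeddingErrorBound_of_dim_zero]
    rw [this, measureReal_empty]
    positivity
  have hF : ∀ᵐ x ∂F, ‖x‖ ≤ 1 := hF𝒳.mono fun x hx => norm_le_one_of_inner_mem (h𝒳 x hx x hx)
  have hin : ∀ n, ∀ᵐ ω ∂μ n, ∀ i j, inner ℝ (X n ω i) (X n ω j) ∈ Set.Icc (0 : ℝ) 1 := by
    intro n
    have h1 : ∀ᵐ ω ∂μ n, ∀ i, X n ω i ∈ 𝒳 := ae_all_iff.mpr fun i =>
      ae_of_ae_map ((hR n).measurable_pos i).aemeasurable (by rw [(hR n).law_pos i]; exact hF𝒳)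
    filter_upwards [h1] with ω hω i j using h𝒳 _ (hω i) _ (hω j)
  obtain ⟨δ', hδ', hM'⟩ := (posSemidef_secondMoment hF).exists_pos_le_quadForm hrank
  set δ := δ' / 2 with hδdef
  have hδ : 0 < δ := half_pos hδ'
  have hM : ∀ u : Fin d → ℝ, 2 * δ * (u ⬝ᵥ u) ≤ u ⬝ᵥ (secondMoment F *ᵥ u) := by
    intro u
    rw [hδdef, mul_div_cancel₀ _ (two_ne_zero)]
    exact hM' u
  have hd0 : (0 : ℝ) < d := by exact_mod_cast hd
  have hlog : Filter.Tendsto (fun n : ℕ => Real.log n) Filter.atTop Filter.atTop :=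
    Real.tendsto_log_atTop.comp tendsto_natCast_atTop_atTop
  have hsqrt : Filter.Tendsto (fun n : ℕ => √(Real.log n)) Filter.atTop Filter.atTop :=
    Real.tendsto_sqrt_atTop.comp hlog
  -- None of these conditions involves ρ, so the regime may change with n.
  filter_upwards [hlog.eventually_ge_atTop (6 + c), Filter.eventually_ge_atTop 3,
    Filter.eventually_ge_atTop (2 * d),
    eventually_mul_exp_le_rpow (d * (d * 2)) ((δ / d) ^ 2 / 2) (c + 1) (by positivity),
    (hsqrt.const_mul_atTop hδ).eventually_ge_atTop (6 * (√d * noiseConst c + 1)),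
    (hsqrt.const_mul_atTop (pow_pos hδ 2)).eventually_gt_atTop (6 * (√d * noiseConst c + 1)),
    hlog.eventually_ge_atTop (rowErrorConst (√d * noiseConst c + 1) δ)]
    with n e1 e2 e3 e4 e5 e6 e7
  rcases le_total ((n : ℝ) * ρ n) (Real.log n ^ 2) with hs | hs
  · refine (hR n).measureReal_not_bound_of_sparse (hρ n).1 (hρ n).2 (hin n) hd (by omega)
      (by linarith) hs ?_
    set L := Real.log n
    have g1 : 2 * L ^ 2 + (c + 1) * L ≤ 3 * L ^ 2 := by nlinarith
    have g2 : L / 2 ≤ L - 1 := by linarith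
    calc 2 * L ^ 2 + (c + 1) * L ≤ 3 * L ^ 2 := g1
      _ ≤ 5 ^ 2 * (L / 2) ^ 2 := by nlinarith [sq_nonneg L]
      _ ≤ (L - 1) ^ 2 * (L - 1) ^ 2 := by
          gcongr
          linarith
      _ = _ := by ring
  · refine (hR n).measureReal_not_bound_of_dense (hρ n).1 (hρ n).2 (hin n) hF hd hδ hM hc
      (by linarith) hs e2 e3 (le_trans (le_of_eq ?_) e4) e5 e6 e7
    rw [show -(n * (δ / d) ^ 2) / 2 = -((δ / d) ^ 2 / 2 * n) by ring]
    ring
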